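/- Let $\mathbb K$ be a field and let $E=(E^0,E^1,r,s)$ be a directed graph without isolated vertices (every vertex is the source or the range of some edge). Let $L_{\mathbb K}(E)$ be the Leavitt path algebra of $E$: the (not necessarily unital) $\mathbb K$-algebra generated by pairwise orthogonal idempotents $v\in E^0$ and elements $f,f^*$ ($f\in E^1$) subject to $s(f)f=fr(f)=f$, $r(f)f^*=f^*s(f)=f^*$, $f^*f'=\delta_{f,f'}r(f)$, and $v=\sum_{s(f)=v}ff^*$ whenever $s^{-1}(v)$ is finite and non-empty. Let $W$ be the set of finite paths of nonzero length, let $\mathbb F$ be the free group on $E^1$, and let $X$ be the set consisting of the sinks of $E$, the paths in $W$ whose range is a sink, and the infinite paths. For $g\in\mathbb F$ define $X_g\subseteq X$ by: $X_e=X$; $X_{b^{-1}}=\{\xi\in X: s(\xi)=r(b)\}$ for $b\in W$; $X_a=\{\xi\in X:\xi \text{ begins with } a\}$ for $a\in W$; $X_{ab^{-1}}=X_a$ for $a,b\in W$ with $r(a)=r(b)$ and $ab^{-1}$ reduced; and $X_g=\emptyset$ for all other $g$. Let $1_g:X\to\mathbb K$ be the characteristic function of $X_g$. For an infinite emitter $v$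 (a vertex with $s^{-1}(v)$ infinite) consider the formal series $\sum_{s(f)=v}1_f$; at each point of $X$ at most one of its terms is nonzero, and it is identified with the function on $X$ that is its pointwise sum. Let $$D^s(X)=\operatorname{span}_{\mathbb K}\Big(\{1_g: g\in\mathbb F\setminus\{e\}\}\cup\Big\{\sum_{s(f)=v}1_f : v\text{ an infinite emitter}\Big\}\Big),$$ which is an algebra under pointwise multiplication. For $f\in E^1$ let $\theta_f:X_{f^{-1}}\to X_f$ be the bijection that puts $f$ in front of $\xi$ (with $\theta_f(r(f))=f$ if $r(f)$ is a sink), and let $\beta_f:1_{f^{-1}}D^s(X)\to 1_fD^s(X)$ be the algebra isomorphism $\varphi\mapsto\varphi\circ\theta_f^{-1}$ (extended by zero outside $X_f$); it satisfies $\beta_f(1_{f^{-1}}1_h)=1_f1_{fh}$ for all $h\in\mathbb F$. Let $\beta=(D^s_g,\beta_g)_{g\in\mathbb F}$ be the semi-saturated partial action of $\mathbb F$ on $D^s(X)$ generated by the partial symmetries $\beta_f$: for $g$ with reduced word $x_1\cdots x_n$, $\beta_g=\beta_{x_1}\circ\cdots\circ\beta_{x_n}$ as a composition of partial bijections, where $\beta_{f^{-1}}=\beta_f^{-1}$,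 and $D^s_g$ is the range of $\beta_g$. Let $D^s(X)\star_\beta\mathbb F=\bigoplus_{g\in\mathbb F}D^s_g\delta_g$ be the partial skew group ring, with product $(x\delta_g)(y\delta_h)=\beta_g(\beta_{g^{-1}}(x)\,y)\,\delta_{gh}$. Then $L_{\mathbb K}(E)$ and $D^s(X)\star_\beta\mathbb F$ are isomorphic as $\mathbb K$-algebras. -/

import Mathlib

universe u v w

/-! ## Partial actions on algebras and partial skew group rings -/

/-- A partial action of the group `G` on the (not necessarily unital) `K`-algebra `R`: ideals `D g`
and algebra isomorphisms `act g : D g⁻¹ → D g` satisfying the three axioms of a partial action. -/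
structure AlgPartialAction (G : Type u) (K : Type v) (R : Type w) [Group G] [CommRing K]
    [NonUnitalRing R] [Module K R] where
  /-- the ideal `D g` -/
  D : G → Submodule K R
  mul_mem_left : ∀ (g : G) (r x : R), x ∈ D g → r * x ∈ D g
  mul_mem_right : ∀ (g : G) (r x : R), x ∈ D g → x * r ∈ D g
  /-- the isomorphism from `D g⁻¹` onto `D g` -/
  act : ∀ g : G, D g⁻¹ ≃ₗ[K] D g
  act_mul : ∀ (g : G) (x y : D g⁻¹),
    (act g ⟨(x : R) * (y : R), mul_mem_left _ _ _ y.2⟩ : R) = (act g x : R) * (act g y : R)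
  D_one : D 1 = ⊤
  act_one : ∀ x : D (1 : G)⁻¹, (act 1 x : R) = (x : R)
  image_inter : ∀ g h : G,
    {y : R | ∃ x : D g⁻¹, (x : R) ∈ D h ∧ (act g x : R) = y} = (D g : Set R) ∩ (D (g * h) : Set R)
  act_act : ∀ (g h : G) (r : R) (h₁ : r ∈ D h⁻¹) (h₂ : r ∈ D (g * h)⁻¹)
    (h₃ : (act h ⟨r, h₁⟩ : R) ∈ D g⁻¹), (act g ⟨_, h₃⟩ : R) = (act (g * h) ⟨r, h₂⟩ : R)

namespace AlgPartialAction

section Skew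

variable {G : Type u} {K : Type v} {R : Type w} [Group G] [CommRing K]
  [NonUnitalRing R] [Module K R] (P : AlgPartialAction G K R)

/-- `act g⁻¹` and `(act g)⁻¹` agree on `D g`. -/
theorem act_inv (g : G) (x : R) (hx : x ∈ P.D g) (hx' : x ∈ P.D g⁻¹⁻¹) :
    (P.act g⁻¹ ⟨x, hx'⟩ : R) = ((P.act g).symm ⟨x, hx⟩ : R) := by
  set y := (P.act g).symm ⟨x, hx⟩ with hy
  have hxy : (P.act g y : R) = x := by simp [hy]
  have key := P.act_act g⁻¹ g (y : R) y.2 (by rw [inv_mul_cancel, inv_one, P.D_one]; trivial)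
    (by simpa [hxy] using hx')
  have h1 : ∀ (k : G) (hk : k = 1) (z : R) (hz : z ∈ P.D k⁻¹), (P.act k ⟨z, hz⟩ : R) = z := by
    intro k hk z hz
    subst hk
    exact P.act_one _
  rw [h1 _ (inv_mul_cancel g)] at key
  rw [← key]
  congr 2
  exact Subtype.ext hxy.symm

theorem mul_aux (g h : G) (r : P.D g) (r' : P.D h) :
    ((P.act g ⟨((P.act g).symm r : R) * (r' : R),
      P.mul_mem_right _ _ _ ((P.act g).symm r).2⟩ : P.D g) : R) ∈ P.D (g * h) := by
  have : ((P.act g ⟨((P.act g).symm r : R) * (r' : R),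
      P.mul_mem_right _ _ _ ((P.act g).symm r).2⟩ : P.D g) : R) ∈
      (P.D g : Set R) ∩ (P.D (g * h) : Set R) := by
    rw [← P.image_inter]
    exact ⟨_, P.mul_mem_left _ _ _ r'.2, rfl⟩
  exact this.2

/-- The partial skew group ring: the direct sum of the `D g δ_g`, where `r δ_g` is the element `r`
in the summand of index `g`. -/
def SkewGroupRing : Type (max u w) := DirectSum G (fun g => P.D g)

noncomputable instance : AddCommGroup P.SkewGroupRing :=
  inferInstanceAs (AddCommGroup (DirectSum G (fun g => P.D g)))

noncomputable instance : Module K P.SkewGroupRing :=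
  inferInstanceAs (Module K (DirectSum G (fun g => P.D g)))

open Classical in
/-- The element `r δ_g`. -/
noncomputable def delta (g : G) : P.D g →ₗ[K] P.SkewGroupRing :=
  DirectSum.lof K G (fun g => P.D g) g

open Classical in
/-- The linear map out of the direct sum with given restrictions to the summands. -/
noncomputable def lift {N : Type*} [AddCommGroup N] [Module K N] (F : ∀ g, P.D g →ₗ[K] N) :
    P.SkewGroupRing →ₗ[K] N :=
  DirectSum.toModule K G N F

theorem lift_delta {N : Type*} [AddCommGroup N] [Module K N] (F : ∀ g, P.D g →ₗ[K] N)
    (g : G) (r : P.D g) : P.lift F (P.delta g r) = F g r := by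
  classical
  exact DirectSum.toModule_lof K g r (M := fun g => P.D g) (φ := F)

variable [SMulCommClass K R R] [IsScalarTower K R R]

/-- The product `(r δ_g) (r' δ_h) = act g (act g⁻¹ r * r') δ_{gh}` of homogeneous elements, as a
bilinear map with values in the coefficient of `δ_{gh}`; recall `act g⁻¹ = (act g)⁻¹`. -/
def mulHomogeneous (g h : G) : P.D g →ₗ[K] P.D h →ₗ[K] P.D (g * h) :=
  LinearMap.mk₂ K
    (fun r r' => ⟨(P.act g ⟨((P.act g).symm r : R) * (r' : R),
      P.mul_mem_right _ _ _ ((P.act g).symm r).2⟩ : P.D g), P.mul_aux g h r r'⟩)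
    (fun a b c => Subtype.ext <| Eq.trans
      (congrArg (fun z : P.D g⁻¹ => (P.act g z : R)) (Subtype.ext (by simp [add_mul])))
      (congrArg Subtype.val (map_add (P.act g) ⟨((P.act g).symm a : R) * (c : R),
        P.mul_mem_right _ _ _ ((P.act g).symm a).2⟩ ⟨((P.act g).symm b : R) * (c : R),
        P.mul_mem_right _ _ _ ((P.act g).symm b).2⟩)))
    (fun k a c => Subtype.ext <| Eq.trans
      (congrArg (fun z : P.D g⁻¹ => (P.act g z : R)) (Subtype.ext (by simp [smul_mul_assoc])))
      (congrArg Subtype.val (map_smul (P.act g) k ⟨((P.act g).symm a : R) * (c : R),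
        P.mul_mem_right _ _ _ ((P.act g).symm a).2⟩)))
    (fun a b c => Subtype.ext <| Eq.trans
      (congrArg (fun z : P.D g⁻¹ => (P.act g z : R)) (Subtype.ext (by simp [mul_add])))
      (congrArg Subtype.val (map_add (P.act g) ⟨((P.act g).symm a : R) * (b : R),
        P.mul_mem_right _ _ _ ((P.act g).symm a).2⟩ ⟨((P.act g).symm a : R) * (c : R),
        P.mul_mem_right _ _ _ ((P.act g).symm a).2⟩)))
    (fun k a c => Subtype.ext <| Eq.trans
      (congrArg (fun z : P.D g⁻¹ => (P.act g z : R)) (Subtype.ext (by simp [mul_smul_comm])))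
      (congrArg Subtype.val (map_smul (P.act g) k ⟨((P.act g).symm a : R) * (c : R),
        P.mul_mem_right _ _ _ ((P.act g).symm a).2⟩)))

/-- The multiplication of the partial skew group ring: the bilinear extension of
`mulHomogeneous`. -/
noncomputable def skewMul : P.SkewGroupRing →ₗ[K] P.SkewGroupRing →ₗ[K] P.SkewGroupRing :=
  P.lift fun g => LinearMap.flip (P.lift fun h =>
      LinearMap.flip ((P.mulHomogeneous g h).compr₂ (P.delta (g * h))))

noncomputable instance : NonUnitalNonAssocRing P.SkewGroupRing where
  mul x y := P.skewMul x y
  left_distrib x y z := map_add (P.skewMul x) y z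
  right_distrib x y z := LinearMap.map_add₂ P.skewMul x y z
  zero_mul x := LinearMap.map_zero₂ P.skewMul x
  mul_zero x := map_zero (P.skewMul x)

theorem delta_mul_delta (g h : G) (r : P.D g) (r' : P.D h) :
    P.delta g r * P.delta h r' = P.delta (g * h) (P.mulHomogeneous g h r r') := by
  change P.skewMul _ _ = _
  rw [skewMul, lift_delta, LinearMap.flip_apply, lift_delta]
  rfl

end Skew

/-! ### Partial actions from partial symmetries -/

section OfPEquiv

variable {K : Type v} {R : Type w} [CommRing K] [NonUnitalRing R] [Module K R]

/-- A partial symmetry whose domain is an ideal and which respects the algebra operations. -/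
structure IsPartialAlgHom (K : Type v) {R : Type w} [CommRing K] [NonUnitalRing R] [Module K R]
    (φ : R ≃. R) : Prop where
  zero : (0 : R) ∈ φ 0
  add : ∀ x y x' y', x' ∈ φ x → y' ∈ φ y → x' + y' ∈ φ (x + y)
  smul : ∀ (k : K) x x', x' ∈ φ x → k • x' ∈ φ (k • x)
  mul : ∀ x y x' y', x' ∈ φ x → y' ∈ φ y → x' * y' ∈ φ (x * y)
  ideal_left : ∀ r x x', x' ∈ φ x → ∃ z, z ∈ φ (r * x)
  ideal_right : ∀ r x x', x' ∈ φ x → ∃ z, z ∈ φ (x * r)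

/-- The range of a partial symmetry, as a submodule. -/
def rangeSubmodule (φ : R ≃. R) (h : IsPartialAlgHom K φ) : Submodule K R where
  carrier := {y | ∃ x, y ∈ φ x}
  zero_mem' := ⟨0, h.zero⟩
  add_mem' := fun ⟨x, hx⟩ ⟨y, hy⟩ => ⟨x + y, h.add _ _ _ _ hx hy⟩
  smul_mem' := fun k _ ⟨x, hx⟩ => ⟨k • x, h.smul _ _ _ hx⟩

theorem mem_rangeSubmodule (φ : R ≃. R) (h : IsPartialAlgHom K φ) (y : R) :
    y ∈ rangeSubmodule φ h ↔ ∃ x, y ∈ φ x := Iff.rfl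

variable {G : Type u} [Group G]

/-- A family `β` of partial symmetries with `β 1 = id`, `β g⁻¹ = (β g)⁻¹` and
`β g ∘ β h ⊆ β (g h)`, each of which is an algebra isomorphism between ideals, is a partial action;
its ideal `D g` is the range of `β g`. -/
def ofPEquiv (β : G → R ≃. R) (h1 : β 1 = PEquiv.refl R) (hinv : ∀ g, β g⁻¹ = (β g).symm)
    (hmul : ∀ g h, (β h).trans (β g) ≤ β (g * h)) (hβ : ∀ g, IsPartialAlgHom K (β g)) :
    AlgPartialAction G K R :=
  have hdom : ∀ (g : G) (x : rangeSubmodule (β g⁻¹) (hβ g⁻¹)), (β g x).isSome := fun g x => by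
    obtain ⟨x, y, hy⟩ := x
    rw [hinv, PEquiv.mem_iff_mem] at hy
    exact Option.isSome_iff_exists.2 ⟨y, hy⟩
  have hran : ∀ (g : G) (x : rangeSubmodule (β g) (hβ g)), (β g⁻¹ x).isSome := fun g x => by
    obtain ⟨x, y, hy⟩ := x
    rw [← PEquiv.mem_iff_mem, ← hinv] at hy
    exact Option.isSome_iff_exists.2 ⟨y, hy⟩
  have hget : ∀ (g : G) (x) (h : (β g x).isSome), (β g x).get h ∈ β g x := fun g x h =>
    Option.get_mem h
  have hget_eq : ∀ (g : G) (x y) (h : (β g x).isSome), y ∈ β g x → (β g x).get h = y :=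
    fun g x y h hy => Option.get_of_mem h hy
  have hmem : ∀ (g : G) (x y : R), x ∈ β g⁻¹ y ↔ y ∈ β g x := fun g x y => by
    rw [hinv, PEquiv.mem_iff_mem]
  { D := fun g => rangeSubmodule (β g) (hβ g)
    mul_mem_left := fun g r x ⟨y, hy⟩ => by
      obtain ⟨z, hz⟩ := (hβ g⁻¹).ideal_left r x y ((hmem g y x).2 hy)
      exact ⟨z, (hmem g z _).1 hz⟩
    mul_mem_right := fun g r x ⟨y, hy⟩ => by
      obtain ⟨z, hz⟩ := (hβ g⁻¹).ideal_right r x y ((hmem g y x).2 hy)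
      exact ⟨z, (hmem g z _).1 hz⟩
    act := fun g =>
      { toFun := fun x => ⟨(β g x).get (hdom g x), x, hget _ _ _⟩
        invFun := fun y => ⟨(β g⁻¹ y).get (hran g y), y, hget _ _ _⟩
        map_add' := fun x y => Subtype.ext <| hget_eq _ _ _ _ <|
          (hβ g).add _ _ _ _ (hget _ _ _) (hget _ _ _)
        map_smul' := fun k x => Subtype.ext <| hget_eq _ _ _ _ <| (hβ g).smul _ _ _ (hget _ _ _)
        left_inv := fun x => Subtype.ext <| hget_eq _ _ _ _ <| (hmem g _ _).2 (hget _ _ _)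
        right_inv := fun x => Subtype.ext <| hget_eq _ _ _ _ <| (hmem g _ _).1 (hget _ _ _) }
    act_mul := fun g x y => hget_eq _ _ _ _ <| (hβ g).mul _ _ _ _ (hget _ _ _) (hget _ _ _)
    D_one := by
      refine eq_top_iff.2 fun x _ => ⟨x, ?_⟩
      rw [h1]; rfl
    act_one := fun x => hget_eq _ _ _ _ <| by rw [h1]; rfl
    image_inter := fun g h => by
      ext y
      constructor
      · rintro ⟨x, ⟨z, hz⟩, rfl⟩
        exact ⟨⟨x, hget _ _ _⟩, z, hmul g h _ _
          ((PEquiv.mem_trans _ _ _ _).2 ⟨_, hz, hget _ _ _⟩)⟩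
      · rintro ⟨⟨x, hx⟩, z, hz⟩
        have hx' := (hmem g x y).2 hx
        refine ⟨⟨x, y, hx'⟩, ⟨z, ?_⟩, hget_eq _ _ _ _ hx⟩
        have := hmul g⁻¹ (g * h) z x ((PEquiv.mem_trans _ _ _ _).2 ⟨_, hz, hx'⟩)
        rwa [inv_mul_cancel_left] at this
    act_act := fun g h r h₁ h₂ h₃ => Eq.symm <| hget_eq _ _ _ _ <| hmul g h _ _ <|
      (PEquiv.mem_trans _ _ _ _).2 ⟨_, hget _ _ (hdom h ⟨r, h₁⟩), hget _ _ (hdom g ⟨_, h₃⟩)⟩ }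

end OfPEquiv

/-! ### The semi-saturated partial action of a free group generated by partial symmetries -/

section FreeGroup

variable {A : Type u} {R : Type w}

/-- The partial symmetry attached to a letter `f` or `f⁻¹`. -/
def letterSymm (β : A → R ≃. R) (x : A × Bool) : R ≃. R :=
  if x.2 then β x.1 else (β x.1).symm

/-- The composition of the partial symmetries along a word; the last letter acts first. Partial maps
are composed on the largest domain on which the composition makes sense. -/
def wordSymm (β : A → R ≃. R) : List (A × Bool) → R ≃. R
  | [] => PEquiv.refl R
  | x :: l => (wordSymm β l).trans (letterSymm β x)

open Classical in
/-- The value at `g` of the semi-saturated partial action of the free group generated by the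
partial symmetries `β f`: their composition along the reduced word of `g`. -/
noncomputable def freeSymm (β : A → R ≃. R) (g : FreeGroup A) : R ≃. R := wordSymm β g.toWord

theorem wordSymm_append (β : A → R ≃. R) (l l' : List (A × Bool)) :
    wordSymm β (l ++ l') = (wordSymm β l').trans (wordSymm β l) := by
  induction l with
  | nil => simp [wordSymm]
  | cons x l ih => simp [wordSymm, ih, PEquiv.trans_assoc]

theorem letterSymm_not (β : A → R ≃. R) (a : A) (b : Bool) :
    letterSymm β (a, !b) = (letterSymm β (a, b)).symm := by
  cases b <;> simp [letterSymm]

theorem wordSymm_invRev (β : A → R ≃. R) (l : List (A × Bool)) :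
    wordSymm β (FreeGroup.invRev l) = (wordSymm β l).symm := by
  induction l with
  | nil => rfl
  | cons x l ih =>
    obtain ⟨a, b⟩ := x
    have : FreeGroup.invRev ((a, b) :: l) = FreeGroup.invRev l ++ [(a, !b)] := by
      simp [FreeGroup.invRev]
    rw [this, wordSymm_append, ih]
    simp [wordSymm, letterSymm_not, PEquiv.symm_trans_rev]

theorem symm_trans_le (φ : R ≃. R) : (φ.symm).trans φ ≤ PEquiv.refl R := by
  intro a b h
  obtain ⟨c, h1, h2⟩ := (PEquiv.mem_trans _ _ _ _).1 h
  rw [PEquiv.mem_iff_mem] at h1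
  rw [Option.mem_def] at h1 h2 ⊢
  rw [PEquiv.refl_apply, ← h1, h2]

theorem trans_mono {φ φ' ψ ψ' : R ≃. R} (h : φ ≤ φ') (h' : ψ ≤ ψ') :
    φ.trans ψ ≤ φ'.trans ψ' := by
  intro a b hab
  obtain ⟨c, h1, h2⟩ := (PEquiv.mem_trans _ _ _ _).1 hab
  exact (PEquiv.mem_trans _ _ _ _).2 ⟨c, h _ _ h1, h' _ _ h2⟩

theorem wordSymm_le_of_red (β : A → R ≃. R) {l l' : List (A × Bool)} (h : FreeGroup.Red l l') :
    wordSymm β l ≤ wordSymm β l' := by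
  induction h with
  | refl => exact le_rfl
  | tail _ hs ih =>
    refine ih.trans ?_
    cases hs with
    | @not L₁ L₂ x b =>
      rw [wordSymm_append, wordSymm_append]
      refine trans_mono ?_ le_rfl
      have : wordSymm β ((x, b) :: (x, !b) :: L₂) =
          (wordSymm β L₂).trans (((letterSymm β (x, b)).symm).trans (letterSymm β (x, b))) := by
        simp [wordSymm, letterSymm_not, PEquiv.trans_assoc]
      rw [this]
      calc _ ≤ (wordSymm β L₂).trans (PEquiv.refl R) := trans_mono le_rfl (symm_trans_le _)
        _ = _ := PEquiv.trans_refl _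

theorem freeSymm_one (β : A → R ≃. R) : freeSymm β 1 = PEquiv.refl R := by
  simp [freeSymm, wordSymm]

theorem freeSymm_of (β : A → R ≃. R) (f : A) : freeSymm β (FreeGroup.of f) = β f := by
  simp [freeSymm, wordSymm, letterSymm]

theorem freeSymm_inv (β : A → R ≃. R) (g : FreeGroup A) :
    freeSymm β g⁻¹ = (freeSymm β g).symm := by
  classical
  simp only [freeSymm]
  rw [FreeGroup.toWord_inv, wordSymm_invRev]

theorem freeSymm_mul (β : A → R ≃. R) (g h : FreeGroup A) :
    (freeSymm β h).trans (freeSymm β g) ≤ freeSymm β (g * h) := by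
  classical
  simp only [freeSymm]
  rw [← wordSymm_append, FreeGroup.toWord_mul]
  exact wordSymm_le_of_red β FreeGroup.reduce.red

open Classical in
/-- Semi-saturation: `β (g h) = β g ∘ β h` if there is no cancellation in the product `g h`. -/
theorem freeSymm_mul_of_norm (β : A → R ≃. R) (g h : FreeGroup A)
    (hgh : (g * h).norm = g.norm + h.norm) :
    freeSymm β (g * h) = (freeSymm β h).trans (freeSymm β g) := by
  have key : (g * h).toWord = g.toWord ++ h.toWord := by
    rw [FreeGroup.toWord_mul]
    refine (FreeGroup.reduce.red.sublist).eq_of_length ?_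
    rw [← FreeGroup.toWord_mul, List.length_append]
    exact hgh
  simp only [freeSymm]
  rw [← wordSymm_append, ← key]

variable {K : Type v} [CommRing K] [NonUnitalRing R] [Module K R]

theorem IsPartialAlgHom.refl : IsPartialAlgHom K (PEquiv.refl R) where
  zero := rfl
  add := by rintro x y x' y' ⟨⟩ ⟨⟩; rfl
  smul := by rintro k x x' ⟨⟩; rfl
  mul := by rintro x y x' y' ⟨⟩ ⟨⟩; rfl
  ideal_left r x x' _ := ⟨r * x, rfl⟩
  ideal_right r x x' _ := ⟨x * r, rfl⟩

/-- The composition `ψ ∘ φ`, if the domain of `φ` has local units. -/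
theorem IsPartialAlgHom.trans {φ ψ : R ≃. R} (hφ : IsPartialAlgHom K φ)
    (hψ : IsPartialAlgHom K ψ)
    (hu : ∀ x x', x' ∈ φ x → ∃ e e', e' ∈ φ e ∧ e * x = x ∧ x * e = x) :
    IsPartialAlgHom K (φ.trans ψ) where
  zero := (PEquiv.mem_trans _ _ _ _).2 ⟨0, hφ.zero, hψ.zero⟩
  add x y x' y' hx hy := by
    obtain ⟨a, ha, ha'⟩ := (PEquiv.mem_trans _ _ _ _).1 hx
    obtain ⟨b, hb, hb'⟩ := (PEquiv.mem_trans _ _ _ _).1 hy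
    exact (PEquiv.mem_trans _ _ _ _).2 ⟨_, hφ.add _ _ _ _ ha hb, hψ.add _ _ _ _ ha' hb'⟩
  smul k x x' hx := by
    obtain ⟨a, ha, ha'⟩ := (PEquiv.mem_trans _ _ _ _).1 hx
    exact (PEquiv.mem_trans _ _ _ _).2 ⟨_, hφ.smul _ _ _ ha, hψ.smul _ _ _ ha'⟩
  mul x y x' y' hx hy := by
    obtain ⟨a, ha, ha'⟩ := (PEquiv.mem_trans _ _ _ _).1 hx
    obtain ⟨b, hb, hb'⟩ := (PEquiv.mem_trans _ _ _ _).1 hy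
    exact (PEquiv.mem_trans _ _ _ _).2 ⟨_, hφ.mul _ _ _ _ ha hb, hψ.mul _ _ _ _ ha' hb'⟩
  ideal_left r x x' hx := by
    obtain ⟨a, ha, ha'⟩ := (PEquiv.mem_trans _ _ _ _).1 hx
    obtain ⟨e, e', he, hex, -⟩ := hu x a ha
    obtain ⟨c, hc⟩ := hφ.ideal_left r e e' he
    obtain ⟨d, hd⟩ := hψ.ideal_left c a x' ha'
    refine ⟨d, (PEquiv.mem_trans _ _ _ _).2 ⟨c * a, ?_, hd⟩⟩
    have := hφ.mul _ _ _ _ hc ha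
    rwa [mul_assoc, hex] at this
  ideal_right r x x' hx := by
    obtain ⟨a, ha, ha'⟩ := (PEquiv.mem_trans _ _ _ _).1 hx
    obtain ⟨e, e', he, -, hxe⟩ := hu x a ha
    obtain ⟨c, hc⟩ := hφ.ideal_right r e e' he
    obtain ⟨d, hd⟩ := hψ.ideal_right c a x' ha'
    refine ⟨d, (PEquiv.mem_trans _ _ _ _).2 ⟨a * c, ?_, hd⟩⟩
    have := hφ.mul _ _ _ _ ha hc
    rwa [← mul_assoc, hxe] at this

theorem isPartialAlgHom_wordSymm (β : A → R ≃. R)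
    (hβ : ∀ x, IsPartialAlgHom K (letterSymm β x))
    (hu : ∀ a x x', x' ∈ letterSymm β a x → ∃ e e', e' ∈ letterSymm β a e ∧ e * x = x ∧ x * e = x)
    (l : List (A × Bool)) : IsPartialAlgHom K (wordSymm β l) := by
  induction l using List.reverseRecOn with
  | nil => exact IsPartialAlgHom.refl
  | append_singleton l x ih =>
    rw [wordSymm_append]
    have : wordSymm β [x] = letterSymm β x := by simp [wordSymm]
    rw [this]
    exact (hβ x).trans ih (hu x)

/-- The partial action of the free group generated by partial symmetries, each of which is an
isomorphism between ideals with (local) units. -/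
noncomputable def ofGenerators (β : A → R ≃. R)
    (hβ : ∀ x, IsPartialAlgHom K (letterSymm β x))
    (hu : ∀ a x x', x' ∈ letterSymm β a x →
      ∃ e e', e' ∈ letterSymm β a e ∧ e * x = x ∧ x * e = x) :
    AlgPartialAction (FreeGroup A) K R :=
  ofPEquiv (freeSymm β) (freeSymm_one β) (freeSymm_inv β) (freeSymm_mul β)
    (fun _ => isPartialAlgHom_wordSymm β hβ hu _)

end FreeGroup

end AlgPartialAction

/-! ## Graphs, paths, Leavitt path algebras -/

/-- A directed graph with vertices `V`, edges `A`, source map `s` and range map `r`. -/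
structure DirGraph (V : Type u) (A : Type v) where
  s : A → V
  r : A → V

namespace DirGraph

variable {V : Type u} {A : Type v} (E : DirGraph V A)

def IsSink (x : V) : Prop := ∀ f, E.s f ≠ x

def IsSource (x : V) : Prop := ∀ f, E.r f ≠ x

def IsIsolated (x : V) : Prop := E.IsSink x ∧ E.IsSource x

def IsInfiniteEmitter (x : V) : Prop := {f | E.s f = x}.Infinite

/-- The generators of the Leavitt path algebra. -/
inductive LeavittGen (V : Type u) (A : Type v) : Type (max u v)
  | vertex : V → LeavittGen V A
  | edge : A → LeavittGen V A
  | ghost : A → LeavittGen V A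

section Leavitt

variable (K : Type w) [Field K]

/-- A generator as an element of the free algebra. -/
def freeGen (x : LeavittGen V A) : FreeAlgebra K (LeavittGen V A) := FreeAlgebra.ι K x

open LeavittGen in
/-- The defining relations of the Leavitt path algebra. -/
inductive LeavittRel :
    FreeAlgebra K (LeavittGen V A) → FreeAlgebra K (LeavittGen V A) → Prop
  | vertex_idem (x : V) :
      LeavittRel (freeGen K (vertex x) * freeGen K (vertex x)) (freeGen K (vertex x))
  | vertex_orth (x y : V) (h : x ≠ y) :
      LeavittRel (freeGen K (vertex x) * freeGen K (vertex y)) 0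
  | source_edge (f : A) :
      LeavittRel (freeGen K (vertex (E.s f)) * freeGen K (edge f)) (freeGen K (edge f))
  | edge_range (f : A) :
      LeavittRel (freeGen K (edge f) * freeGen K (vertex (E.r f))) (freeGen K (edge f))
  | range_ghost (f : A) :
      LeavittRel (freeGen K (vertex (E.r f)) * freeGen K (ghost f)) (freeGen K (ghost f))
  | ghost_source (f : A) :
      LeavittRel (freeGen K (ghost f) * freeGen K (vertex (E.s f))) (freeGen K (ghost f))
  | ghost_edge_self (f : A) :
      LeavittRel (freeGen K (ghost f) * freeGen K (edge f)) (freeGen K (vertex (E.r f)))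
  | ghost_edge_ne (f g : A) (h : f ≠ g) :
      LeavittRel (freeGen K (ghost f) * freeGen K (edge g)) 0
  | vertex_sum (x : V) (hfin : {f | E.s f = x}.Finite) (hne : {f | E.s f = x}.Nonempty) :
      LeavittRel (freeGen K (vertex x))
        (∑ f ∈ hfin.toFinset, freeGen K (edge f) * freeGen K (ghost f))

/-- The image of a generator in the universal unital algebra on the Leavitt relations. -/
noncomputable def leavittGen (x : LeavittGen V A) : RingQuot (E.LeavittRel K) :=
  RingQuot.mkAlgHom K (E.LeavittRel K) (freeGen K x)

/-- The Leavitt path algebra, the universal `K`-algebra (in general without unit) on the Leavitt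
generators and relations. None of the relations involves a constant term, so the universal unital
algebra on them is the unitization of the universal algebra, and the latter is recovered as the
non-unital subalgebra generated by the generators. -/
noncomputable def leavittPathAlgebra : NonUnitalSubalgebra K (RingQuot (E.LeavittRel K)) :=
  NonUnitalAlgebra.adjoin K (Set.range (E.leavittGen K))

end Leavitt

/-- The set `W` of finite paths of nonzero length. -/
structure Path where
  edges : List A
  ne_nil : edges ≠ []
  chain : edges.IsChain fun f g => E.r f = E.s g

variable {E}

namespace Path

def src (a : E.Path) : V := E.s (a.edges.head a.ne_nil)

def rng (a : E.Path) : V := E.r (a.edges.getLast a.ne_nil)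

/-- A path as an element of the free group on the edges. -/
def toGroup (a : E.Path) : FreeGroup A := (a.edges.map FreeGroup.of).prod

end Path

variable (E)

/-- The set `X`: sinks, paths of finite nonzero length that end in a sink, and infinite paths. -/
inductive Boundary : Type (max u v)
  | sink (x : V) (hx : E.IsSink x) : Boundary
  | fin (p : E.Path) (hp : E.IsSink p.rng) : Boundary
  | inf (p : ℕ → A) (hp : ∀ i, E.r (p i) = E.s (p (i + 1))) : Boundary

variable {E}

namespace Boundary

/-- The source of an element of `X`. -/
def src : E.Boundary → V
  | sink x _ => x
  | fin p _ => p.src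
  | inf p _ => E.s (p 0)

/-- The `i`-th edge (counted from `0`) of an element of `X`, if there is one. -/
def edge : E.Boundary → ℕ → Option A
  | sink _ _ => fun _ => none
  | fin p _ => fun i => p.edges[i]?
  | inf p _ => fun i => some (p i)

/-- `ξ` begins with the path `a`. -/
def HasPrefix (ξ : E.Boundary) (a : E.Path) : Prop :=
  ∀ i < a.edges.length, ξ.edge i = a.edges[i]?

open Classical in
/-- The map `θ_{f⁻¹}`, which drops the first edge; it is of interest on elements of `X` that
begin with `f`. -/
noncomputable def shift : E.Boundary → E.Boundary
  | sink x hx => sink x hx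
  | fin p hp =>
    if h : p.edges.tail = [] then sink p.rng hp
    else fin ⟨p.edges.tail, h, p.chain.tail⟩ (by simpa [Path.rng, List.getLast_tail] using hp)
  | inf p hp => inf (fun i => p (i + 1)) fun i => hp (i + 1)

/-- The map `θ_f`, which puts the edge `f` in front of an element of `X` with source `r f`. -/
def cons (f : A) : (ξ : E.Boundary) → ξ.src = E.r f → E.Boundary
  | sink x hx, h => fin ⟨[f], by simp, by simp⟩ (by
      have : x = E.r f := h
      subst this
      simpa [Path.rng] using hx)
  | fin p hp, h => fin ⟨f :: p.edges, by simp, by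
      obtain ⟨l, hl, hc⟩ := p
      obtain ⟨g, l, rfl⟩ := List.exists_cons_of_ne_nil hl
      exact List.isChain_cons_cons.2 ⟨h.symm, hc⟩⟩ (by
        simpa [Path.rng, List.getLast_cons p.ne_nil] using hp)
  | inf p hp, h => inf (fun i => Nat.casesOn i f p) (by
      rintro (_ | i)
      · exact h.symm
      · exact hp i)

theorem ext_edge {ξ η : E.Boundary} (h : ξ.src = η.src) (he : ∀ i, ξ.edge i = η.edge i) :
    ξ = η := by
  have hne : ∀ p : E.Path, p.edges[0]? ≠ none := fun p hp => by
    simp [p.ne_nil] at hp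
  cases ξ with
  | sink x hx =>
    cases η with
    | sink y hy =>
      have : x = y := h
      subst this; rfl
    | fin p hp => exact absurd (he 0).symm (hne p)
    | inf p hp => exact absurd (he 0) (by simp [edge])
  | fin p hp =>
    cases η with
    | sink y hy => exact absurd (he 0) (hne p)
    | fin q hq =>
      have : p.edges = q.edges := List.ext_getElem? he
      obtain ⟨l, h1, h2⟩ := p
      obtain ⟨l', h1', h2'⟩ := q
      obtain rfl : l = l' := this
      rfl
    | inf q hq => exact absurd (he p.edges.length) (by simp [edge])
  | inf p hp =>
    cases η with
    | sink y hy => exact absurd (he 0) (by simp [edge])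
    | fin q hq => exact absurd (he q.edges.length) (by simp [edge])
    | inf q hq =>
      have : p = q := funext fun i => Option.some_injective _ (he i)
      subst this; rfl

theorem edge_cons_zero (f : A) (ξ : E.Boundary) (h) : (cons f ξ h).edge 0 = some f := by
  cases ξ <;> rfl

theorem edge_cons_succ (f : A) (ξ : E.Boundary) (h) (i : ℕ) :
    (cons f ξ h).edge (i + 1) = ξ.edge i := by
  cases ξ <;> rfl

theorem edge_shift (ξ : E.Boundary) (i : ℕ) : ξ.shift.edge i = ξ.edge (i + 1) := by
  cases ξ with
  | sink x hx => rfl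
  | fin p hp =>
    obtain ⟨l, h1, h2⟩ := p
    obtain ⟨g, l, rfl⟩ := List.exists_cons_of_ne_nil h1
    by_cases hl : l = []
    · subst hl; simp [shift, edge]
    · simp [shift, edge, hl]
  | inf p hp => rfl

theorem src_of_edge_zero {ξ : E.Boundary} {f : A} (h : ξ.edge 0 = some f) : ξ.src = E.s f := by
  cases ξ with
  | sink x hx => simp [edge] at h
  | fin p hp =>
    obtain ⟨l, h1, h2⟩ := p
    obtain ⟨g, l, rfl⟩ := List.exists_cons_of_ne_nil h1
    have : g = f := by simpa [edge] using h
    subst this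
    rfl
  | inf p hp =>
    have : p 0 = f := by simpa [edge] using h
    subst this
    rfl

theorem src_shift {ξ : E.Boundary} {f : A} (h : ξ.edge 0 = some f) : ξ.shift.src = E.r f := by
  cases ξ with
  | sink x hx => simp [edge] at h
  | fin p hp =>
    obtain ⟨l, h1, h2⟩ := p
    obtain ⟨g, l, rfl⟩ := List.exists_cons_of_ne_nil h1
    have : g = f := by simpa [edge] using h
    subst this
    by_cases hl : l = []
    · subst hl; simp [shift, src, Path.rng]
    · obtain ⟨g', l, rfl⟩ := List.exists_cons_of_ne_nil hl
      simpa [shift, src, Path.src] using (List.isChain_cons_cons.1 h2).1.symm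
  | inf p hp =>
    have : p 0 = f := by simpa [edge] using h
    subst this
    exact (hp 0).symm

theorem src_cons (f : A) (ξ : E.Boundary) (h) : (cons f ξ h).src = E.s f :=
  src_of_edge_zero (edge_cons_zero f ξ h)

theorem shift_cons (f : A) (ξ : E.Boundary) (h) : (cons f ξ h).shift = ξ :=
  ext_edge ((src_shift (edge_cons_zero f ξ h)).trans h.symm) fun i => by
    rw [edge_shift, edge_cons_succ]

theorem cons_shift (f : A) (ξ : E.Boundary) (h : ξ.edge 0 = some f) :
    cons f ξ.shift (src_shift h) = ξ :=
  ext_edge ((src_cons _ _ _).trans (src_of_edge_zero h).symm) fun i => by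
    cases i with
    | zero => rw [edge_cons_zero, h]
    | succ i => rw [edge_cons_succ, edge_shift]

theorem exists_edge_of_not_isSink {ξ : E.Boundary} (h : ¬ E.IsSink ξ.src) :
    ∃ f, ξ.edge 0 = some f := by
  cases ξ with
  | sink x hx => exact absurd hx h
  | fin p hp => exact ⟨p.edges.head p.ne_nil, by simp [edge, List.head?_eq_some_head p.ne_nil,
      ← List.head?_eq_getElem?]⟩
  | inf p hp => exact ⟨p 0, rfl⟩

end Boundary

/-! ## The sets `X_g` and the algebra of functions -/

variable (E)

/-- The subset `X_g` of `X`: everything for `g = 1`, the elements with source `r b` for `g = b⁻¹`,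
the elements beginning with `a` for `g = a` and for a reduced `g = a b⁻¹` with `r a = r b`, and the
empty set for all other `g`. (In normal form, `a b⁻¹` is reduced when the last edges differ.) -/
def cyl (g : FreeGroup A) : Set E.Boundary :=
  {ξ | g = 1 ∨
    (∃ b : E.Path, g = b.toGroup⁻¹ ∧ ξ.src = b.rng) ∨
    (∃ a : E.Path, g = a.toGroup ∧ ξ.HasPrefix a) ∨
    (∃ a b : E.Path, a.rng = b.rng ∧ a.edges.getLast a.ne_nil ≠ b.edges.getLast b.ne_nil ∧
      g = a.toGroup * b.toGroup⁻¹ ∧ ξ.HasPrefix a)}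

variable (K : Type w) [Field K]

/-- The characteristic function `1_g` of `X_g`. -/
noncomputable def one (g : FreeGroup A) : E.Boundary → K := (E.cyl g).indicator 1

/-- The formal series `∑ 1_f` over the edges `f` with `s f = x`. At each point of `X` at most one of
its terms is different from zero, and the series is identified with the function that is its
pointwise sum. -/
noncomputable def emitterSeries (x : V) : E.Boundary → K :=
  fun ξ => ∑ᶠ f : {f // E.s f = x}, E.one K (FreeGroup.of (f : A)) ξ

/-- The spanning set of `D^s(X)`. -/
def generators : Set (E.Boundary → K) :=
  {φ | ∃ g : FreeGroup A, g ≠ 1 ∧ φ = E.one K g} ∪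
    {φ | ∃ x, E.IsInfiniteEmitter x ∧ φ = E.emitterSeries K x}

/-! ### Normal forms -/

section Words

/-- The word `l l'⁻¹`. -/
def quotWord (l l' : List A) : List (A × Bool) :=
  l.map (fun f => (f, true)) ++ (l'.map (fun f => (f, false))).reverse

theorem quotWord_injective {l₁ l₁' l₂ l₂' : List A} (h : quotWord l₁ l₁' = quotWord l₂ l₂') :
    l₁ = l₂ ∧ l₁' = l₂' := by
  have h1 : ∀ l l' : List A,
      (quotWord l l').filterMap (fun x => if x.2 then some x.1 else none) = l := by
    intro l l'
    simp [quotWord, List.filterMap_append, List.filterMap_map, List.filterMap_reverse]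
  have h2 : ∀ l l' : List A,
      ((quotWord l l').filterMap (fun x => if x.2 then none else some x.1)).reverse = l' := by
    intro l l'
    simp [quotWord, List.filterMap_append, List.filterMap_map, List.filterMap_reverse]
  exact ⟨by rw [← h1 l₁ l₁', h, h1], by rw [← h2 l₁ l₁', h, h2]⟩

theorem mk_quotWord (l l' : List A) :
    FreeGroup.mk (quotWord l l') = (l.map FreeGroup.of).prod * ((l'.map FreeGroup.of).prod)⁻¹ := by
  have h : ∀ l : List A, (l.map FreeGroup.of).prod = FreeGroup.mk (l.map (fun f => (f, true))) := by
    intro l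
    induction l with
    | nil => rfl
    | cons f l ih => simp [ih, FreeGroup.of]
  rw [h, h, FreeGroup.inv_mk, FreeGroup.mul_mk]
  simp [quotWord, FreeGroup.invRev, Function.comp_def]

theorem isReduced_map_const (l : List A) (b : Bool) :
    FreeGroup.IsReduced (l.map (fun f => (f, b))) := by
  rw [FreeGroup.IsReduced, List.isChain_map]
  induction l with
  | nil => exact List.isChain_nil
  | cons x l ih => exact List.IsChain.cons ih (fun _ _ _ => rfl)

theorem isReduced_quotWord (l l' : List A)
    (h : ∀ f ∈ l.getLast?, ∀ g ∈ l'.getLast?, f ≠ g) :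
    FreeGroup.IsReduced (quotWord l l') := by
  refine List.isChain_append.2 ⟨isReduced_map_const l true, ?_, ?_⟩
  · rw [← List.map_reverse]
    exact isReduced_map_const _ false
  · intro x hx y hy hxy
    simp only [List.getLast?_map, List.head?_reverse, Option.mem_def, Option.map_eq_some_iff]
      at hx hy
    obtain ⟨f, hf, rfl⟩ := hx
    obtain ⟨g, hg, rfl⟩ := hy
    exact absurd hxy (h f hf g hg)

open Classical in
theorem toWord_quot (l l' : List A) (h : ∀ f ∈ l.getLast?, ∀ g ∈ l'.getLast?, f ≠ g) :
    ((l.map FreeGroup.of).prod * ((l'.map FreeGroup.of).prod)⁻¹).toWord = quotWord l l' := by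
  rw [← mk_quotWord, FreeGroup.toWord_mk, (isReduced_quotWord l l' h).reduce_eq]

theorem quot_injective {l₁ l₁' l₂ l₂' : List A}
    (h₁ : ∀ f ∈ l₁.getLast?, ∀ g ∈ l₁'.getLast?, f ≠ g)
    (h₂ : ∀ f ∈ l₂.getLast?, ∀ g ∈ l₂'.getLast?, f ≠ g)
    (h : (l₁.map FreeGroup.of).prod * ((l₁'.map FreeGroup.of).prod)⁻¹ =
      (l₂.map FreeGroup.of).prod * ((l₂'.map FreeGroup.of).prod)⁻¹) :
    l₁ = l₂ ∧ l₁' = l₂' := by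
  classical
  apply quotWord_injective
  rw [← toWord_quot _ _ h₁, ← toWord_quot _ _ h₂, h]

end Words

section Cylinders

variable {E}

theorem Path.ext_edges {a b : E.Path} (h : a.edges = b.edges) : a = b := by
  cases a; cases b; simpa using h

/-- The elements of `X` with a given initial word (of any length) and, for the empty word, a
condition on the source. -/
theorem mem_cyl_quot {l l' : List A} (h : ∀ f ∈ l.getLast?, ∀ g ∈ l'.getLast?, f ≠ g)
    (ξ : E.Boundary) :
    ξ ∈ E.cyl ((l.map FreeGroup.of).prod * ((l'.map FreeGroup.of).prod)⁻¹) ↔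
      (l = [] ∧ l' = []) ∨
      (∃ b : E.Path, l = [] ∧ l' = b.edges ∧ ξ.src = b.rng) ∨
      (∃ a : E.Path, l = a.edges ∧ l' = [] ∧ ξ.HasPrefix a) ∨
      (∃ a b : E.Path, a.rng = b.rng ∧ l = a.edges ∧ l' = b.edges ∧ ξ.HasPrefix a) := by
  constructor
  · rintro (h1 | ⟨b, hb, hs⟩ | ⟨a, ha, hp⟩ | ⟨a, b, hr, hl, hab, hp⟩)
    · exact Or.inl (quot_injective (l₂ := []) (l₂' := []) h (by simp) (by simpa using h1))
    · have := quot_injective (l₂ := []) (l₂' := b.edges) h (by simp)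
        (by simpa [Path.toGroup] using hb)
      exact Or.inr (Or.inl ⟨b, this.1, this.2, hs⟩)
    · have := quot_injective (l₂ := a.edges) (l₂' := []) h (by simp)
        (by simpa [Path.toGroup] using ha)
      exact Or.inr (Or.inr (Or.inl ⟨a, this.1, this.2, hp⟩))
    · have := quot_injective (l₂ := a.edges) (l₂' := b.edges) h
        (by simpa [List.getLast?_eq_some_getLast a.ne_nil, List.getLast?_eq_some_getLast b.ne_nil]
          using hl) hab
      exact Or.inr (Or.inr (Or.inr ⟨a, b, hr, this.1, this.2, hp⟩))
  · rintro (⟨rfl, rfl⟩ | ⟨b, rfl, rfl, hs⟩ | ⟨a, rfl, rfl, hp⟩ | ⟨a, b, hr, rfl, rfl, hp⟩)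
    · exact Or.inl (by simp)
    · exact Or.inr (Or.inl ⟨b, by simp [Path.toGroup], hs⟩)
    · exact Or.inr (Or.inr (Or.inl ⟨a, by simp [Path.toGroup], hp⟩))
    · refine Or.inr (Or.inr (Or.inr ⟨a, b, hr, ?_, rfl, hp⟩))
      exact h _ (by simp [List.getLast?_eq_some_getLast a.ne_nil]) _
        (by simp [List.getLast?_eq_some_getLast b.ne_nil])

theorem cyl_toGroup (a : E.Path) : E.cyl a.toGroup = {ξ | ξ.HasPrefix a} := by
  ext ξ
  have := mem_cyl_quot (l := a.edges) (l' := []) (by simp) ξ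
  simp only [List.map_nil, List.prod_nil, inv_one, mul_one] at this
  refine this.trans ?_
  constructor
  · rintro (⟨h, -⟩ | ⟨b, h, -⟩ | ⟨b, h, -, hp⟩ | ⟨c, b, -, -, h, -⟩)
    · exact absurd h a.ne_nil
    · exact absurd h a.ne_nil
    · rwa [Path.ext_edges h]
    · exact absurd h.symm b.ne_nil
  · exact fun h => Or.inr (Or.inr (Or.inl ⟨a, rfl, trivial, h⟩))

theorem cyl_toGroup_inv (b : E.Path) : E.cyl (b.toGroup)⁻¹ = {ξ | ξ.src = b.rng} := by
  ext ξ
  have := mem_cyl_quot (l := []) (l' := b.edges) (by simp) ξ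
  simp only [List.map_nil, List.prod_nil, one_mul] at this
  refine this.trans ?_
  constructor
  · rintro (⟨-, h⟩ | ⟨c, -, h, hs⟩ | ⟨c, -, h, hp⟩ | ⟨c, d, -, h, -, -⟩)
    · exact absurd h b.ne_nil
    · rwa [Path.ext_edges h]
    · exact absurd h b.ne_nil
    · exact absurd h.symm c.ne_nil
  · exact fun h => Or.inr (Or.inl ⟨b, trivial, rfl, h⟩)

theorem cyl_toGroup_mul_inv (a b : E.Path) (hr : a.rng = b.rng)
    (hl : a.edges.getLast a.ne_nil ≠ b.edges.getLast b.ne_nil) :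
    E.cyl (a.toGroup * (b.toGroup)⁻¹) = {ξ | ξ.HasPrefix a} := by
  ext ξ
  have := mem_cyl_quot (l := a.edges) (l' := b.edges)
    (by simpa [List.getLast?_eq_some_getLast a.ne_nil, List.getLast?_eq_some_getLast b.ne_nil]
          using hl) ξ
  refine this.trans ?_
  constructor
  · rintro (⟨h, -⟩ | ⟨c, h, -⟩ | ⟨c, -, h, -⟩ | ⟨c, d, -, h, -, hp⟩)
    · exact absurd h a.ne_nil
    · exact absurd h a.ne_nil
    · exact absurd h b.ne_nil
    · rwa [Path.ext_edges h]
  · exact fun h => Or.inr (Or.inr (Or.inr ⟨a, b, hr, rfl, rfl, h⟩))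

variable (E) in
/-- The path that consists of one edge. -/
def edgePath (f : A) : E.Path := ⟨[f], by simp, by simp⟩

theorem toGroup_edgePath (f : A) : (E.edgePath f).toGroup = FreeGroup.of f := by
  simp [Path.toGroup, edgePath]

theorem mem_cyl_of (f : A) (ξ : E.Boundary) :
    ξ ∈ E.cyl (FreeGroup.of f) ↔ ξ.edge 0 = some f := by
  rw [← toGroup_edgePath (E := E), cyl_toGroup]
  simp [Boundary.HasPrefix, edgePath]

theorem mem_cyl_of_inv (f : A) (ξ : E.Boundary) :
    ξ ∈ E.cyl (FreeGroup.of f)⁻¹ ↔ ξ.src = E.r f := by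
  rw [← toGroup_edgePath (E := E), cyl_toGroup_inv]
  simp [Path.rng, edgePath]

theorem emitterSeries_eq {x : V} (hx : ¬ E.IsSink x) :
    E.emitterSeries K x = {ξ : E.Boundary | ξ.src = x}.indicator 1 := by
  funext ξ
  by_cases h : ξ.src = x
  · subst h
    obtain ⟨f, hf⟩ := Boundary.exists_edge_of_not_isSink hx
    rw [Set.indicator_of_mem (by simp), emitterSeries,
      finsum_eq_single _ (⟨f, (Boundary.src_of_edge_zero hf).symm⟩ : {g // E.s g = ξ.src})]
    · rw [one, Set.indicator_of_mem ((mem_cyl_of f ξ).2 hf)]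
    · rintro ⟨g, hg⟩ hne
      refine Set.indicator_of_notMem (fun hm => hne ?_) _
      rw [mem_cyl_of, hf] at hm
      exact Subtype.ext (Option.some_injective _ hm).symm
  · rw [Set.indicator_of_notMem (by simpa using h), emitterSeries]
    refine finsum_eq_zero_of_forall_eq_zero ?_
    rintro ⟨g, rfl⟩
    refine Set.indicator_of_notMem (fun hm => h ?_) _
    exact Boundary.src_of_edge_zero ((mem_cyl_of g ξ).1 hm)

variable (E) in
/-- The sets whose characteristic functions span `D^s(X)`. -/
inductive IsBasic : Set E.Boundary → Prop
  | empty : IsBasic ∅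
  | pre (a : E.Path) : IsBasic {ξ | ξ.HasPrefix a}
  | src (x : V) (hx : (∃ f, E.r f = x) ∨ E.IsInfiniteEmitter x) : IsBasic {ξ | ξ.src = x}

theorem HasPrefix.edge_zero {ξ : E.Boundary} {a : E.Path} (h : ξ.HasPrefix a) :
    ξ.edge 0 = some (a.edges.head a.ne_nil) := by
  rw [h 0 (List.length_pos_iff.2 a.ne_nil), ← List.head?_eq_getElem?,
    List.head?_eq_some_head a.ne_nil]

theorem IsBasic.inter {S T : Set E.Boundary} (hS : E.IsBasic S) (hT : E.IsBasic T) :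
    E.IsBasic (S ∩ T) := by
  have key : ∀ S T : Set E.Boundary, E.IsBasic S → E.IsBasic T →
      ((S ∩ T).Nonempty → S ⊆ T ∨ T ⊆ S) → E.IsBasic (S ∩ T) := by
    intro S T hS hT h
    rcases (S ∩ T).eq_empty_or_nonempty with h0 | h0
    · rw [h0]; exact .empty
    · rcases h h0 with h1 | h1
      · rwa [Set.inter_eq_left.2 h1]
      · rwa [Set.inter_eq_right.2 h1]
  have hpre : ∀ (a b : E.Path) (ξ : E.Boundary), a.edges.length ≤ b.edges.length →
      ξ.HasPrefix a → ξ.HasPrefix b → {ξ : E.Boundary | ξ.HasPrefix b} ⊆ {ξ | ξ.HasPrefix a} := by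
    intro a b ξ hl ha hb η hη i hi
    rw [hη i (by omega), ← hb i (by omega), ha i hi]
  have hsrc : ∀ (a : E.Path) (x : V) (ξ : E.Boundary), ξ.HasPrefix a → ξ.src = x →
      {ξ : E.Boundary | ξ.HasPrefix a} ⊆ {ξ | ξ.src = x} := by
    intro a x ξ ha hx η hη
    rw [← hx, Set.mem_ofPred_eq, Boundary.src_of_edge_zero (HasPrefix.edge_zero hη),
      Boundary.src_of_edge_zero (HasPrefix.edge_zero ha)]
  refine key S T hS hT ?_
  rintro ⟨ξ, h1, h2⟩
  cases hS with
  | empty => exact h1.elim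
  | pre a =>
    cases hT with
    | empty => exact h2.elim
    | pre b =>
      rcases le_total a.edges.length b.edges.length with h | h
      · exact Or.inr (hpre a b ξ h h1 h2)
      · exact Or.inl (hpre b a ξ h h2 h1)
    | src x hx => exact Or.inl (hsrc a x ξ h1 h2)
  | src x hx =>
    cases hT with
    | empty => exact h2.elim
    | pre b => exact Or.inr (hsrc b x ξ h2 h1)
    | src y hy =>
      have : x = y := h1.symm.trans h2
      subst this
      exact Or.inl subset_rfl

theorem span_generators : Submodule.span K (E.generators K) =
    Submodule.span K {φ | ∃ S, E.IsBasic S ∧ φ = S.indicator 1} := by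
  apply le_antisymm
  · refine Submodule.span_le.2 ?_
    rintro φ (⟨g, hg, rfl⟩ | ⟨x, hx, rfl⟩)
    · have hb : E.IsBasic (E.cyl g) := by
        rcases (E.cyl g).eq_empty_or_nonempty with h0 | ⟨ξ, hξ⟩
        · rw [h0]; exact .empty
        · rcases hξ with h | ⟨b, rfl, -⟩ | ⟨a, rfl, -⟩ | ⟨a, b, hr, hl, rfl, -⟩
          · exact absurd h hg
          · rw [cyl_toGroup_inv]; exact .src _ (Or.inl ⟨_, rfl⟩)
          · rw [cyl_toGroup]; exact .pre a
          · rw [cyl_toGroup_mul_inv a b hr hl]; exact .pre a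
      exact Submodule.subset_span ⟨_, hb, rfl⟩
    · refine Submodule.subset_span ⟨_, .src x (Or.inr hx), emitterSeries_eq K fun hs => ?_⟩
      obtain ⟨f, hf⟩ := hx.nonempty
      exact hs f hf
  · refine Submodule.span_le.2 ?_
    rintro φ ⟨S, hS, rfl⟩
    have hne : ∀ a : E.Path, a.toGroup ≠ 1 := fun a h => by
      have := quot_injective (l₁ := a.edges) (l₁' := []) (l₂ := []) (l₂' := []) (by simp) (by simp)
        (by simpa [Path.toGroup] using h)
      exact a.ne_nil this.1
    cases hS with
    | empty => rw [Set.indicator_empty]; exact Submodule.zero_mem _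
    | pre a =>
      rw [← cyl_toGroup]
      exact Submodule.subset_span (Or.inl ⟨_, hne a, rfl⟩)
    | src x hx =>
      rcases hx with ⟨f, rfl⟩ | hx
      · have : {ξ : E.Boundary | ξ.src = E.r f} = E.cyl ((E.edgePath f).toGroup)⁻¹ := by
          ext ξ
          rw [toGroup_edgePath, mem_cyl_of_inv]; rfl
        rw [this]
        exact Submodule.subset_span (Or.inl ⟨_, by simpa using hne _, rfl⟩)
      · rw [← emitterSeries_eq K fun hs => ?_]
        · exact Submodule.subset_span (Or.inr ⟨x, hx, rfl⟩)
        · obtain ⟨f, hf⟩ := hx.nonempty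
          exact hs f hf

end Cylinders

/-- The algebra `D^s(X)`: the linear span of the functions `1_g`, for `g ≠ 1`, and of the formal
series attached to the infinite emitters. -/
noncomputable def DsX : NonUnitalSubalgebra K (E.Boundary → K) where
  toSubmodule := Submodule.span K (E.generators K)
  mul_mem' := by
    intro φ ψ hφ hψ
    change φ ∈ Submodule.span K _ at hφ
    change ψ ∈ Submodule.span K _ at hψ
    change φ * ψ ∈ Submodule.span K _
    rw [span_generators] at *
    have := Submodule.mul_mem_mul hφ hψ
    rw [Submodule.span_mul_span] at this
    refine Submodule.span_mono ?_ this
    rintro _ ⟨_, ⟨S, hS, rfl⟩, _, ⟨T, hT, rfl⟩, rfl⟩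
    exact ⟨S ∩ T, hS.inter hT, by simp [Set.inter_indicator_one]⟩

/-! ## The partial action `β` -/

theorem indicator_mem_DsX {S : Set E.Boundary} (hS : E.IsBasic S) :
    (S.indicator 1 : E.Boundary → K) ∈ E.DsX K := by
  change _ ∈ Submodule.span K (E.generators K)
  rw [span_generators]
  exact Submodule.subset_span ⟨S, hS, rfl⟩

theorem map_mem_DsX (F : (E.Boundary → K) →ₗ[K] (E.Boundary → K))
    (hF : ∀ S, E.IsBasic S → ∃ T, E.IsBasic T ∧ F (S.indicator 1) = T.indicator 1)
    {φ : E.Boundary → K} (hφ : φ ∈ E.DsX K) : F φ ∈ E.DsX K := by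
  change φ ∈ Submodule.span K (E.generators K) at hφ
  change F φ ∈ Submodule.span K (E.generators K)
  rw [span_generators] at *
  have := Submodule.mem_map_of_mem (f := F) hφ
  rw [Submodule.map_span] at this
  refine Submodule.span_mono ?_ this
  rintro _ ⟨_, ⟨S, hS, rfl⟩, rfl⟩
  exact hF S hS

open Classical in
/-- The linear map `F(X_{f⁻¹}) → F(X_f)`, `φ ↦ φ ∘ θ_{f⁻¹}`, where functions on `X_f` are extended
by zero. -/
noncomputable def push (f : A) : (E.Boundary → K) →ₗ[K] (E.Boundary → K) where
  toFun φ ξ := if ξ ∈ E.cyl (FreeGroup.of f) then φ ξ.shift else 0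
  map_add' φ ψ := by ext ξ; by_cases h : ξ ∈ E.cyl (FreeGroup.of f) <;> simp [h]
  map_smul' k φ := by ext ξ; by_cases h : ξ ∈ E.cyl (FreeGroup.of f) <;> simp [h]

open Classical in
/-- The linear map `F(X_f) → F(X_{f⁻¹})`, `φ ↦ φ ∘ θ_f`, where functions on `X_{f⁻¹}` are extended
by zero; recall that `X_{f⁻¹}` is the set of all elements of `X` with source `r f`. -/
noncomputable def pull (f : A) : (E.Boundary → K) →ₗ[K] (E.Boundary → K) where
  toFun φ ξ := if h : ξ.src = E.r f then φ (ξ.cons f h) else 0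
  map_add' φ ψ := by ext ξ; by_cases h : ξ.src = E.r f <;> simp [h]
  map_smul' k φ := by ext ξ; by_cases h : ξ.src = E.r f <;> simp [h]

variable {E} {K}

theorem push_indicator (f : A) (S : Set E.Boundary) : E.push K f (S.indicator 1) =
    {ξ : E.Boundary | ξ.edge 0 = some f ∧ ξ.shift ∈ S}.indicator 1 := by
  classical
  ext ξ
  simp only [push, LinearMap.coe_mk, AddHom.coe_mk, mem_cyl_of, Set.indicator_apply,
    Set.mem_ofPred_eq]
  by_cases h : ξ.edge 0 = some f <;> simp [h]

theorem pull_indicator (f : A) (S : Set E.Boundary) : E.pull K f (S.indicator 1) =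
    {ξ : E.Boundary | ∃ h : ξ.src = E.r f, ξ.cons f h ∈ S}.indicator 1 := by
  classical
  ext ξ
  simp only [pull, LinearMap.coe_mk, AddHom.coe_mk, Set.indicator_apply, Set.mem_ofPred_eq]
  by_cases h : ξ.src = E.r f <;> simp [h]

theorem push_mem (f : A) {φ : E.Boundary → K} (hφ : φ ∈ E.DsX K) : E.push K f φ ∈ E.DsX K := by
  refine E.map_mem_DsX K _ (fun S hS => ⟨_, ?_, push_indicator f S⟩) hφ
  cases hS with
  | empty => simpa using IsBasic.empty
  | pre a =>
    by_cases h : E.r f = a.src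
    · have hc : (f :: a.edges).IsChain fun f g => E.r f = E.s g := by
        refine List.IsChain.cons a.chain fun y hy => ?_
        rw [List.head?_eq_some_head a.ne_nil, Option.mem_some_iff] at hy
        rw [← hy]; exact h
      convert IsBasic.pre (⟨f :: a.edges, by simp, hc⟩ : E.Path) using 1
      ext ξ
      constructor
      · rintro ⟨h0, hs⟩ (_ | i) hi
        · simpa using h0
        · rw [← Boundary.edge_shift, hs i (by simpa using hi)]; simp
      · intro hp
        refine ⟨by simpa using hp 0 (by simp), fun i hi => ?_⟩
        rw [Boundary.edge_shift, hp (i + 1) (by simpa using hi)]; simp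
    · convert IsBasic.empty using 1
      refine Set.eq_empty_of_forall_notMem ?_
      rintro ξ ⟨h0, hs⟩
      apply h
      rw [← Boundary.src_shift h0, Boundary.src_of_edge_zero (HasPrefix.edge_zero hs)]
      rfl
  | src x hx =>
    by_cases h : E.r f = x
    · convert IsBasic.pre (E.edgePath f) using 1
      ext ξ
      constructor
      · rintro ⟨h0, hs⟩
        simpa [Boundary.HasPrefix, edgePath] using h0
      · intro hp
        have h0 : ξ.edge 0 = some f := by simpa [Boundary.HasPrefix, edgePath] using hp
        exact ⟨h0, (Boundary.src_shift h0).trans h⟩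
    · convert IsBasic.empty using 1
      refine Set.eq_empty_of_forall_notMem ?_
      rintro ξ ⟨h0, hs⟩
      exact h ((Boundary.src_shift h0).symm.trans hs)

theorem pull_mem (f : A) {φ : E.Boundary → K} (hφ : φ ∈ E.DsX K) : E.pull K f φ ∈ E.DsX K := by
  refine E.map_mem_DsX K _ (fun S hS => ⟨_, ?_, pull_indicator f S⟩) hφ
  have hr : E.IsBasic {ξ | ξ.src = E.r f} := .src _ (Or.inl ⟨f, rfl⟩)
  cases hS with
  | empty => simpa using IsBasic.empty
  | pre a =>
    obtain ⟨l, hl, hc⟩ := a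
    obtain ⟨g, l, rfl⟩ := List.exists_cons_of_ne_nil hl
    by_cases h : g = f
    · subst h
      by_cases hl' : l = []
      · subst hl'
        convert hr using 1
        ext ξ
        refine ⟨fun h => h.1, fun h => ⟨h, fun i hi => ?_⟩⟩
        obtain rfl : i = 0 := by simpa using hi
        simp [Boundary.edge_cons_zero]
      · convert hr.inter (IsBasic.pre (⟨l, hl', hc.tail⟩ : E.Path)) using 1
        ext ξ
        constructor
        · rintro ⟨h, hp⟩
          refine ⟨h, fun i hi => ?_⟩
          rw [← Boundary.edge_cons_succ g ξ h, hp (i + 1) (by simpa using hi)]; simp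
        · rintro ⟨h, hp⟩
          refine ⟨h, ?_⟩
          rintro (_ | i) hi
          · simp [Boundary.edge_cons_zero]
          · rw [Boundary.edge_cons_succ, hp i (by simpa using hi)]; simp
    · convert IsBasic.empty using 1
      refine Set.eq_empty_of_forall_notMem ?_
      rintro ξ ⟨h', hp⟩
      have := hp 0 (by simp)
      rw [Boundary.edge_cons_zero] at this
      exact h (by simpa using this.symm)
  | src x hx =>
    by_cases h : E.s f = x
    · convert hr using 1
      ext ξ
      exact ⟨fun h => h.1, fun h' => ⟨h', (Boundary.src_cons _ _ _).trans h⟩⟩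
    · convert IsBasic.empty using 1
      refine Set.eq_empty_of_forall_notMem ?_
      rintro ξ ⟨h', hp⟩
      exact h ((Boundary.src_cons _ _ _).symm.trans hp)

theorem of_ne_one (f : A) : FreeGroup.of f ≠ 1 := by
  simp

variable (E K)

theorem one_mem (g : FreeGroup A) (hg : g ≠ 1) : E.one K g ∈ E.DsX K :=
  Submodule.subset_span (Or.inl ⟨g, hg, rfl⟩)

/-- The set `1_g D^s(X)`, for `g = f` or `g = f⁻¹`. -/
def oneMul (g : FreeGroup A) : Set (E.DsX K) :=
  {φ | ∃ ψ : E.DsX K, (φ : E.Boundary → K) = E.one K g * (ψ : E.Boundary → K)}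

variable {E K}

theorem one_mul_one (g : FreeGroup A) : E.one K g * E.one K g = E.one K g := by
  ext ξ
  by_cases h : ξ ∈ E.cyl g <;> simp [one, h]

theorem mem_oneMul_iff (g : FreeGroup A) (φ : E.DsX K) :
    φ ∈ E.oneMul K g ↔ E.one K g * (φ : E.Boundary → K) = φ := by
  constructor
  · rintro ⟨ψ, hψ⟩
    rw [hψ, ← mul_assoc, one_mul_one]
  · exact fun h => ⟨φ, h.symm⟩

theorem one_mul_push (f : A) (φ : E.Boundary → K) :
    E.one K (FreeGroup.of f) * E.push K f φ = E.push K f φ := by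
  ext ξ
  by_cases h : ξ ∈ E.cyl (FreeGroup.of f) <;> simp [one, push, h]

theorem one_mul_pull (f : A) (φ : E.Boundary → K) :
    E.one K (FreeGroup.of f)⁻¹ * E.pull K f φ = E.pull K f φ := by
  ext ξ
  by_cases h : ξ.src = E.r f
  · have : ξ ∈ E.cyl (FreeGroup.of f)⁻¹ := (mem_cyl_of_inv f ξ).2 h
    simp [one, this]
  · simp [pull, h]

theorem pull_push (f : A) (φ : E.Boundary → K) :
    E.pull K f (E.push K f φ) = E.one K (FreeGroup.of f)⁻¹ * φ := by
  ext ξ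
  by_cases h : ξ.src = E.r f
  · have h1 : ξ ∈ E.cyl (FreeGroup.of f)⁻¹ := (mem_cyl_of_inv f ξ).2 h
    have h2 : ξ.cons f h ∈ E.cyl (FreeGroup.of f) :=
      (mem_cyl_of _ _).2 (Boundary.edge_cons_zero _ _ _)
    simp [one, h1, pull, push, h, h2, Boundary.shift_cons]
  · have h1 : ξ ∉ E.cyl (FreeGroup.of f)⁻¹ := fun hm => h ((mem_cyl_of_inv f ξ).1 hm)
    simp [one, h1, pull, h]

theorem push_pull (f : A) (φ : E.Boundary → K) :
    E.push K f (E.pull K f φ) = E.one K (FreeGroup.of f) * φ := by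
  ext ξ
  by_cases h : ξ ∈ E.cyl (FreeGroup.of f)
  · have h1 := (mem_cyl_of f ξ).1 h
    simp [one, h, pull, push, Boundary.src_shift h1, Boundary.cons_shift f ξ h1]
  · simp [one, h, push]

theorem push_mul (f : A) (φ ψ : E.Boundary → K) :
    E.push K f (φ * ψ) = E.push K f φ * E.push K f ψ := by
  ext ξ
  by_cases h : ξ ∈ E.cyl (FreeGroup.of f) <;> simp [push, h]

theorem pull_mul (f : A) (φ ψ : E.Boundary → K) :
    E.pull K f (φ * ψ) = E.pull K f φ * E.pull K f ψ := by
  ext ξ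
  by_cases h : ξ.src = E.r f <;> simp [pull, h]

variable (E K)

open Classical in
/-- The partial symmetry `β_f` of `D^s(X)`, from `1_{f⁻¹} D^s(X)` onto `1_f D^s(X)`. It maps
`1_{f⁻¹} 1_h` to `1_f 1_{f h}`, see `edgeSymm_one`. -/
noncomputable def edgeSymm (f : A) : E.DsX K ≃. E.DsX K where
  toFun φ :=
    if φ ∈ E.oneMul K (FreeGroup.of f)⁻¹ then some ⟨E.push K f φ, push_mem f φ.2⟩ else none
  invFun φ :=
    if φ ∈ E.oneMul K (FreeGroup.of f) then some ⟨E.pull K f φ, pull_mem f φ.2⟩ else none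
  inv φ ψ := by
    simp only [Option.ite_none_right_eq_some, Option.some.injEq]
    constructor
    · rintro ⟨h, rfl⟩
      refine ⟨(mem_oneMul_iff _ _).2 (one_mul_pull f _), Subtype.ext ?_⟩
      exact (push_pull f _).trans ((mem_oneMul_iff _ _).1 h)
    · rintro ⟨h, rfl⟩
      refine ⟨(mem_oneMul_iff _ _).2 (one_mul_push f _), Subtype.ext ?_⟩
      exact (pull_push f _).trans ((mem_oneMul_iff _ _).1 h)

variable {E K}

theorem mem_edgeSymm (f : A) (φ ψ : E.DsX K) : ψ ∈ E.edgeSymm K f φ ↔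
    φ ∈ E.oneMul K (FreeGroup.of f)⁻¹ ∧ E.push K f φ = ψ := by
  classical
  change ψ ∈ (if φ ∈ E.oneMul K (FreeGroup.of f)⁻¹ then
    some (⟨E.push K f φ, push_mem f φ.2⟩ : E.DsX K) else none) ↔ _
  simp [Option.mem_def, Subtype.ext_iff]

theorem mem_edgeSymm_symm (f : A) (φ ψ : E.DsX K) : ψ ∈ (E.edgeSymm K f).symm φ ↔
    φ ∈ E.oneMul K (FreeGroup.of f) ∧ E.pull K f φ = ψ := by
  classical
  change ψ ∈ (if φ ∈ E.oneMul K (FreeGroup.of f) then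
    some (⟨E.pull K f φ, pull_mem f φ.2⟩ : E.DsX K) else none) ↔ _
  simp [Option.mem_def, Subtype.ext_iff]

theorem isPartialAlgHom_aux (φ : E.DsX K ≃. E.DsX K) (g : FreeGroup A)
    (F : (E.Boundary → K) →ₗ[K] (E.Boundary → K)) (hF : ∀ x y, F (x * y) = F x * F y)
    (hmem : ∀ x ∈ E.DsX K, F x ∈ E.DsX K)
    (h : ∀ x y, y ∈ φ x ↔ x ∈ E.oneMul K g ∧ F x = y) :
    AlgPartialAction.IsPartialAlgHom K φ where
  zero := (h _ _).2 ⟨(mem_oneMul_iff _ _).2 (by simp), by simp⟩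
  add x y x' y' hx hy := by
    rw [h, mem_oneMul_iff] at *
    exact ⟨by simp [mul_add, hx.1, hy.1], by simp [hx.2, hy.2]⟩
  smul k x x' hx := by
    rw [h, mem_oneMul_iff] at *
    exact ⟨by simp [hx.1], by simp [hx.2]⟩
  mul x y x' y' hx hy := by
    rw [h, mem_oneMul_iff] at *
    exact ⟨by simp [← mul_assoc, hx.1], by simp [hx.2, hy.2, hF]⟩
  ideal_left r x x' hx := by
    refine ⟨⟨_, hmem _ (r * x).2⟩, ?_⟩
    rw [h, mem_oneMul_iff] at *
    refine ⟨?_, rfl⟩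
    change _ * ((r : E.Boundary → K) * (x : E.Boundary → K)) = r * x
    rw [mul_left_comm, hx.1]
  ideal_right r x x' hx := by
    refine ⟨⟨_, hmem _ (x * r).2⟩, ?_⟩
    rw [h, mem_oneMul_iff] at *
    refine ⟨?_, rfl⟩
    change _ * ((x : E.Boundary → K) * (r : E.Boundary → K)) = x * r
    rw [← mul_assoc, hx.1]

theorem isPartialAlgHom_edgeSymm (x : A × Bool) :
    AlgPartialAction.IsPartialAlgHom K (AlgPartialAction.letterSymm (E.edgeSymm K) x) := by
  obtain ⟨f, b⟩ := x
  cases b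
  · exact isPartialAlgHom_aux _ _ (E.pull K f) (pull_mul f) (fun _ h => pull_mem f h)
      (mem_edgeSymm_symm f)
  · exact isPartialAlgHom_aux _ _ (E.push K f) (push_mul f) (fun _ h => push_mem f h)
      (mem_edgeSymm f)

theorem unit_aux (φ : E.DsX K ≃. E.DsX K) (g : FreeGroup A) (hg : g ≠ 1)
    (F : (E.Boundary → K) → (E.Boundary → K)) (hmem : ∀ x ∈ E.DsX K, F x ∈ E.DsX K)
    (h : ∀ x y, y ∈ φ x ↔ x ∈ E.oneMul K g ∧ F x = y) (x x' : E.DsX K) (hx : x' ∈ φ x) :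
    ∃ e e', e' ∈ φ e ∧ e * x = x ∧ x * e = x := by
  refine ⟨⟨E.one K g, E.one_mem K g hg⟩, ⟨_, hmem _ (E.one_mem K g hg)⟩,
    (h _ _).2 ⟨(mem_oneMul_iff _ _).2 (one_mul_one g), rfl⟩, ?_⟩
  have := (mem_oneMul_iff _ _).1 ((h _ _).1 hx).1
  exact ⟨Subtype.ext this, Subtype.ext ((mul_comm _ _).trans this)⟩

theorem unit_edgeSymm (a : A × Bool) (x x' : E.DsX K)
    (hx : x' ∈ AlgPartialAction.letterSymm (E.edgeSymm K) a x) :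
    ∃ e e', e' ∈ AlgPartialAction.letterSymm (E.edgeSymm K) a e ∧ e * x = x ∧ x * e = x := by
  obtain ⟨f, b⟩ := a
  cases b
  · exact unit_aux _ _ (of_ne_one f) (E.pull K f) (fun _ h => pull_mem f h)
      (mem_edgeSymm_symm f) x x' hx
  · exact unit_aux _ _ (inv_ne_one.2 (of_ne_one f)) (E.push K f) (fun _ h => push_mem f h)
      (mem_edgeSymm f) x x' hx

theorem shift_mem_cyl_iff (f : A) (h : FreeGroup A) (ξ : E.Boundary)
    (hξ : ξ ∈ E.cyl (FreeGroup.of f)) :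
    ξ.shift ∈ E.cyl h ↔ ξ ∈ E.cyl (FreeGroup.of f * h) := by
  have h0 := (mem_cyl_of f ξ).1 hξ
  have hsrc := Boundary.src_shift h0
  have hs := Boundary.src_of_edge_zero h0
  have hcons : ∀ a : E.Path, ξ.shift.HasPrefix a → ∃ c : E.Path, c.edges = f :: a.edges ∧
      c.toGroup = FreeGroup.of f * a.toGroup ∧ ξ.HasPrefix c ∧
      c.edges.getLast c.ne_nil = a.edges.getLast a.ne_nil := by
    intro a ha
    refine ⟨⟨f :: a.edges, by simp, List.IsChain.cons a.chain fun y hy => ?_⟩, rfl,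
      by simp [Path.toGroup], ?_, by simp [List.getLast_cons a.ne_nil]⟩
    · rw [List.head?_eq_some_head a.ne_nil, Option.mem_some_iff] at hy
      rw [← hsrc, Boundary.src_of_edge_zero (HasPrefix.edge_zero ha), hy]
    · rintro (_ | i) hi
      · simpa using h0
      · rw [← Boundary.edge_shift, ha i (by simpa using hi)]; simp
  have huncons : ∀ a : E.Path, ξ.HasPrefix a → a.edges = [f] ∨ ∃ c : E.Path,
      a.edges = f :: c.edges ∧ a.toGroup = FreeGroup.of f * c.toGroup ∧ ξ.shift.HasPrefix c ∧
      a.edges.getLast a.ne_nil = c.edges.getLast c.ne_nil := by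
    intro a ha
    have h1 := (HasPrefix.edge_zero ha).symm.trans h0
    obtain ⟨l, hl, hc⟩ := a
    obtain ⟨g, l, rfl⟩ := List.exists_cons_of_ne_nil hl
    obtain rfl : g = f := by simpa using h1
    by_cases hl' : l = []
    · subst hl'; exact Or.inl rfl
    · refine Or.inr ⟨⟨l, hl', hc.tail⟩, rfl, by simp [Path.toGroup], fun i hi => ?_,
        by simp [List.getLast_cons hl']⟩
      rw [Boundary.edge_shift, ha (i + 1) (by simpa using hi)]; simp
  constructor
  · rintro (rfl | ⟨b, rfl, hb⟩ | ⟨a, rfl, ha⟩ | ⟨a, b, hr, hl, rfl, ha⟩)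
    · simpa using hξ
    · have hbr : E.r f = b.rng := hsrc.symm.trans hb
      by_cases hlast : f = b.edges.getLast b.ne_nil
      · by_cases hd : b.edges.dropLast = []
        · have hbe := List.dropLast_append_getLast b.ne_nil
          rw [hd, List.nil_append, ← hlast] at hbe
          exact Or.inl (by simp [Path.toGroup, ← hbe])
        · have hbe := List.dropLast_append_getLast b.ne_nil
          rw [← hlast] at hbe
          refine Or.inr (Or.inl ⟨⟨b.edges.dropLast, hd, b.chain.dropLast⟩, ?_, ?_⟩)
          · have hpr := congrArg (fun l => (l.map FreeGroup.of).prod) hbe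
            simp only [List.map_append, List.prod_append, List.map_cons, List.map_nil,
              List.prod_singleton] at hpr
            rw [Path.toGroup, Path.toGroup, ← hpr]
            simp
          · have hch := b.chain
            rw [← hbe] at hch
            rw [hs]
            exact ((List.isChain_append.1 hch).2.2 _
              (List.getLast?_eq_some_getLast hd) f (by simp)).symm
      · refine Or.inr (Or.inr (Or.inr ⟨E.edgePath f, b, hbr, hlast, ?_, ?_⟩))
        · rw [toGroup_edgePath]
        · simpa [Boundary.HasPrefix, edgePath] using h0
    · obtain ⟨c, -, hc, hp, -⟩ := hcons a ha
      exact Or.inr (Or.inr (Or.inl ⟨c, hc.symm, hp⟩))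
    · obtain ⟨c, -, hc, hp, hl'⟩ := hcons a ha
      refine Or.inr (Or.inr (Or.inr ⟨c, b, ?_, ?_, by rw [hc, mul_assoc], hp⟩))
      · rw [← hr, Path.rng, Path.rng, hl']
      · rwa [hl']
  · rintro (hk | ⟨b, hk, hb⟩ | ⟨a, hk, ha⟩ | ⟨a, b, hr, hl, hk, ha⟩)
    · obtain rfl : h = (FreeGroup.of f)⁻¹ := eq_inv_of_mul_eq_one_right hk
      exact (mem_cyl_of_inv _ _).2 hsrc
    · obtain rfl := eq_inv_mul_of_mul_eq hk
      refine Or.inr (Or.inl ⟨⟨b.edges ++ [f], by simp, ?_⟩, ?_, ?_⟩)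
      · refine List.isChain_append.2 ⟨b.chain, by simp, fun x hx y hy => ?_⟩
        rw [List.getLast?_eq_some_getLast b.ne_nil, Option.mem_some_iff] at hx
        obtain rfl : f = y := by simpa using hy
        rw [← hx, ← hs, hb]
        rfl
      · simp [Path.toGroup]
      · simpa [Path.rng] using hsrc
    · obtain rfl := eq_inv_mul_of_mul_eq hk
      rcases huncons a ha with h1 | ⟨c, -, hc, hp, -⟩
      · exact Or.inl (by simp [Path.toGroup, h1])
      · exact Or.inr (Or.inr (Or.inl ⟨c, by simp [hc], hp⟩))
    · obtain rfl := eq_inv_mul_of_mul_eq hk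
      rcases huncons a ha with h1 | ⟨c, -, hc, hp, hl'⟩
      · refine Or.inr (Or.inl ⟨b, by simp [Path.toGroup, h1], ?_⟩)
        rw [hsrc, ← hr]
        simp [Path.rng, h1]
      · refine Or.inr (Or.inr (Or.inr ⟨c, b, ?_, ?_, by simp [hc, mul_assoc], hp⟩))
        · rw [← hr, Path.rng, Path.rng, hl']
        · rwa [← hl']

/-- The defining property of `β_f`. -/
theorem edgeSymm_one (f : A) (h : FreeGroup A) (φ ψ : E.DsX K)
    (hφ : (φ : E.Boundary → K) = E.one K (FreeGroup.of f)⁻¹ * E.one K h)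
    (hψ : (ψ : E.Boundary → K) = E.one K (FreeGroup.of f) * E.one K (FreeGroup.of f * h)) :
    E.edgeSymm K f φ = some ψ := by
  refine (mem_edgeSymm f φ ψ).2 ⟨(mem_oneMul_iff _ _).2 ?_, ?_⟩
  · rw [hφ, ← mul_assoc, one_mul_one]
  · rw [hφ, hψ]
    ext ξ
    by_cases hξ : ξ ∈ E.cyl (FreeGroup.of f)
    · have h1 := (mem_cyl_of f ξ).1 hξ
      have h2 : ξ.shift ∈ E.cyl (FreeGroup.of f)⁻¹ := (mem_cyl_of_inv _ _).2 (Boundary.src_shift h1)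
      have h3 := shift_mem_cyl_iff f h ξ hξ
      by_cases h4 : ξ.shift ∈ E.cyl h
      · simp [push, one, hξ, h2, h4, h3.1 h4]
      · simp [push, one, hξ, h2, h4, mt h3.2 h4]
    · simp [push, one, hξ]

variable (E K)

/-- The partial action `β` of the free group on the edges on `D^s(X)`: the semi-saturated partial
action generated by the partial symmetries `β_f`. -/
noncomputable def betaAction : AlgPartialAction (FreeGroup A) K (E.DsX K) :=
  AlgPartialAction.ofGenerators (E.edgeSymm K) isPartialAlgHom_edgeSymm unit_edgeSymm

end DirGraph

/-!
The elements `1_f δ_f` and `1_{f⁻¹} δ_{f⁻¹}`, together with the characteristic functions of the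
sets `{ξ ∈ X : s(ξ) = v}` placed in degree `1`, satisfy the defining relations of the Leavitt path
algebra in the partial skew group ring, which is associative because each ideal `D^s_g` has local
units. This gives a homomorphism from `L_K(E)`.

It is injective by a graded uniqueness argument. It respects the gradings by the free group and
kills no vertex, since every vertex is the source of an element of `X`, so one may consider a
homogeneous element of the kernel. The monomials `l x l'*` of a given degree extend a common pair
of words, hence multiplication by ghost edges on the left and by edges on the right brings the
element into degree `1`. There it is a combination of monomials `l x l*`, and the compressions
`y ↦ f* y f` shorten them until only vertices are left.

It is surjective because the characteristic functions of the sets of all `ξ` beginning with a given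
path arise from vertices by conjugation with edges, and `D^s_g δ_g` is reached by multiplying with
the letters of the reduced word of `g` one at a time.
-/

/-! ### Associativity of partial skew group rings -/

namespace AlgPartialAction

section Associativity

variable {G : Type u} {K : Type v} {R : Type w} [Group G] [CommRing K]
  [NonUnitalRing R] [Module K R] (P : AlgPartialAction G K R)

/-- Every element of an ideal of the partial action has a left unit in that ideal. -/
def HasLeftLocalUnits : Prop := ∀ (g : G) (x : R), x ∈ P.D g → ∃ e ∈ P.D g, e * x = x

/-- The element `act g (act g⁻¹ r * c)`. For `c ∈ D h` it is the coefficient of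
`(r δ_g) (c δ_h)`, but it makes sense for every `c`. -/
def twistedMul (g : G) (r : P.D g) (c : R) : P.D g :=
  P.act g ⟨((P.act g).symm r : R) * c, P.mul_mem_right _ _ _ ((P.act g).symm r).2⟩

theorem act_symm_mul (g : G) (r r' : P.D g) :
    ((P.act g).symm ⟨(r : R) * r', P.mul_mem_left _ _ _ r'.2⟩ : R) =
      (P.act g).symm r * (P.act g).symm r' := by
  have h := P.act_mul g ((P.act g).symm r) ((P.act g).symm r')
  simp only [LinearEquiv.apply_symm_apply] at h
  have h' : P.act g ⟨(P.act g).symm r * ((P.act g).symm r' : R),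
      P.mul_mem_left _ _ _ ((P.act g).symm r').2⟩ = ⟨(r : R) * r', P.mul_mem_left _ _ _ r'.2⟩ :=
    Subtype.ext h
  rw [← h', LinearEquiv.symm_apply_apply]

theorem act_symm_one (r : P.D 1) : ((P.act 1).symm r : R) = r := by
  rw [← P.act_one, LinearEquiv.apply_symm_apply]

theorem twistedMul_mul_of_mem (g : G) (u r : P.D g) (c : R) :
    (P.twistedMul g ⟨(u : R) * r, P.mul_mem_left _ _ _ r.2⟩ c : R) = u * P.twistedMul g r c := by
  have h := P.act_mul g ((P.act g).symm u) ⟨((P.act g).symm r : R) * c,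
    P.mul_mem_right _ _ _ ((P.act g).symm r).2⟩
  rw [LinearEquiv.apply_symm_apply] at h
  simpa only [twistedMul, act_symm_mul, mul_assoc] using h

/-- The commutation of left and right multipliers of the ideals on which associativity of the
partial skew group ring rests. -/
theorem twistedMul_mul (hP : P.HasLeftLocalUnits) (g : G) (a : R) (r : P.D g) (c : R) :
    (P.twistedMul g ⟨a * r, P.mul_mem_left _ _ _ r.2⟩ c : R) = a * P.twistedMul g r c := by
  obtain ⟨e, he, her⟩ := hP g r r.2
  have unit_mul : e * (P.twistedMul g r c : R) = P.twistedMul g r c := by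
    simpa only [her, Subtype.coe_eta] using (P.twistedMul_mul_of_mem g ⟨e, he⟩ r c).symm
  simpa only [mul_assoc, her, unit_mul] using
    P.twistedMul_mul_of_mem g ⟨a * e, P.mul_mem_left _ _ _ he⟩ r c

theorem delta_congr {g h : G} (hgh : g = h) (x : P.D g) (y : P.D h) (hxy : (x : R) = y) :
    P.delta g x = P.delta h y := by
  subst hgh
  rw [Subtype.ext hxy]

variable {P} in
theorem SkewGroupRing.induction {p : P.SkewGroupRing → Prop} (zero : p 0)
    (delta : ∀ g x, p (P.delta g x)) (add : ∀ x y, p x → p y → p (x + y))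
    (x : P.SkewGroupRing) : p x := by
  classical
  exact DirectSum.induction_on (β := fun g => P.D g) x zero delta add

theorem delta_injective (g : G) : Function.Injective (P.delta g) := by
  classical
  exact DirectSum.of_injective (β := fun g => P.D g) g

theorem iSupIndep_range_delta : iSupIndep fun g => LinearMap.range (P.delta g) := by
  classical
  refine iSupIndep_def.2 fun g => Submodule.disjoint_def.2 ?_
  rintro _ ⟨r, rfl⟩ hr
  have others_le_ker : (⨆ (h) (_ : h ≠ g), LinearMap.range (P.delta h)) ≤
      LinearMap.ker (DirectSum.component K G (fun g => P.D g) g) := iSup₂_le fun h hh => by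
    rintro _ ⟨r', rfl⟩
    exact (DirectSum.component.of (R := K) (M := fun g => P.D g) g h r').trans (dif_neg hh)
  have r_eq_zero : r = 0 :=
    (DirectSum.component.lof_self (R := K) (ι := G) (M := fun g => P.D g) g r).symm.trans
      (others_le_ker hr)
  rw [r_eq_zero, map_zero]

variable [SMulCommClass K R R] [IsScalarTower K R R]

theorem coe_mulHomogeneous (g h : G) (r : P.D g) (r' : P.D h) :
    (P.mulHomogeneous g h r r' : R) = P.twistedMul g r r' := rfl

theorem act_symm_mulHomogeneous (g h : G) (a : P.D g) (b : P.D h) :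
    ((P.act (g * h)).symm (P.mulHomogeneous g h a b) : R) =
      (P.act h).symm ⟨(P.act g).symm a * (b : R), P.mul_mem_left _ _ _ b.2⟩ := by
  set ab : P.D h := ⟨(P.act g).symm a * (b : R), P.mul_mem_left _ _ _ b.2⟩
  have mem : (ab : R) ∈ P.D g⁻¹ := P.mul_mem_right _ _ _ ((P.act g).symm a).2
  set w := (P.act h).symm ab
  have act_w : P.act h w = ab := LinearEquiv.apply_symm_apply _ _
  have w_mem : (w : R) ∈ P.D (g * h)⁻¹ := by
    have ab_mem : (ab : R) ∈ P.D h⁻¹⁻¹ := by rw [inv_inv]; exact ab.2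
    have : (w : R) ∈ (P.D h⁻¹ : Set R) ∩ (P.D (h⁻¹ * g⁻¹) : Set R) := by
      rw [← P.image_inter]
      exact ⟨⟨ab, ab_mem⟩, mem, P.act_inv h ab ab.2 ab_mem⟩
    rw [mul_inv_rev]
    exact this.2
  have : P.mulHomogeneous g h a b = P.act (g * h) ⟨w, w_mem⟩ := by
    refine Subtype.ext ?_
    rw [← P.act_act g h w w.2 w_mem (by rwa [Subtype.coe_eta, act_w])]
    simp only [Subtype.coe_eta, act_w]
    rfl
  rw [this, LinearEquiv.symm_apply_apply]

theorem mulHomogeneous_assoc (hP : P.HasLeftLocalUnits) (g h k : G) (a : P.D g) (b : P.D h)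
    (c : P.D k) : (P.mulHomogeneous (g * h) k (P.mulHomogeneous g h a b) c : R) =
      P.mulHomogeneous g (h * k) a (P.mulHomogeneous h k b c) := by
  set ab : P.D h := ⟨(P.act g).symm a * (b : R), P.mul_mem_left _ _ _ b.2⟩
  set w := (P.act h).symm ab
  have w_mem : (w : R) ∈ P.D (g * h)⁻¹ := by
    rw [← P.act_symm_mulHomogeneous]
    exact Subtype.coe_prop _
  have act_wc : (P.act h ⟨w * (c : R), P.mul_mem_right _ _ _ w.2⟩ : R) =
      (P.act g).symm a * (P.mulHomogeneous h k b c : R) := P.twistedMul_mul hP h _ b c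
  calc (P.mulHomogeneous (g * h) k (P.mulHomogeneous g h a b) c : R)
      = P.act (g * h) ⟨w * (c : R), P.mul_mem_right _ _ _ w_mem⟩ := by
        simp only [coe_mulHomogeneous, twistedMul, act_symm_mulHomogeneous]
        rfl
    _ = P.act g ⟨(P.act h ⟨w * (c : R), P.mul_mem_right _ _ _ w.2⟩ : R), by
          rw [act_wc]; exact P.mul_mem_right _ _ _ (Subtype.coe_prop _)⟩ :=
        (P.act_act g h _ _ _ _).symm
    _ = P.mulHomogeneous g (h * k) a (P.mulHomogeneous h k b c) := by
        simp only [act_wc]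
        rfl

theorem skew_mul_assoc (hP : P.HasLeftLocalUnits) (x y z : P.SkewGroupRing) :
    x * y * z = x * (y * z) := by
  induction x using SkewGroupRing.induction with
  | zero => simp only [zero_mul]
  | add x x' hx hx' => simp only [add_mul, hx, hx']
  | delta g a =>
    induction y using SkewGroupRing.induction with
    | zero => simp only [zero_mul, mul_zero]
    | add y y' hy hy' => simp only [mul_add, add_mul, hy, hy']
    | delta h b =>
      induction z using SkewGroupRing.induction with
      | zero => simp only [mul_zero]
      | add z z' hz hz' => simp only [mul_add, hz, hz']
      | delta k c =>
        simp only [delta_mul_delta]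
        exact P.delta_congr (mul_assoc _ _ _) _ _ (P.mulHomogeneous_assoc hP g h k a b c)

instance : IsScalarTower K P.SkewGroupRing P.SkewGroupRing :=
  ⟨fun k x y => LinearMap.map_smul₂ P.skewMul k x y⟩

instance : SMulCommClass K P.SkewGroupRing P.SkewGroupRing :=
  ⟨fun k x y => ((P.skewMul x).map_smul k y).symm⟩

theorem delta_one_mul_delta (g : G) (r : P.D 1) (r' : P.D g) :
    P.delta 1 r * P.delta g r' = P.delta g ⟨(r : R) * r', P.mul_mem_left _ _ _ r'.2⟩ := by
  rw [delta_mul_delta]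
  refine P.delta_congr (one_mul g) _ _ ?_
  simp only [coe_mulHomogeneous, twistedMul, P.act_one, act_symm_one]

end Associativity

section Generators

variable {A : Type u} {K : Type v} {R : Type w} [CommRing K] [NonUnitalRing R] [Module K R]
  {β : A → R ≃. R} (hβ : ∀ x, IsPartialAlgHom K (letterSymm β x))
  (hu : ∀ a x x', x' ∈ letterSymm β a x → ∃ e e', e' ∈ letterSymm β a e ∧ e * x = x ∧ x * e = x)

include hβ hu in
theorem exists_unit_wordSymm (hR : ∀ x : R, ∃ e, e * x = x) (l : List (A × Bool)) (x y : R)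
    (hy : y ∈ wordSymm β l x) : ∃ d e, e ∈ wordSymm β l d ∧ e * y = y := by
  induction l generalizing x y with
  | nil =>
    obtain ⟨e, he⟩ := hR y
    exact ⟨e, e, rfl, he⟩
  | cons a l ih =>
    obtain ⟨z, hz, hzy⟩ := (PEquiv.mem_trans _ _ _ _).1 hy
    obtain ⟨d, e, hde, hez⟩ := ih x z hz
    obtain ⟨u, u', hu', huz, -⟩ := hu a z y hzy
    -- `e` is a unit for `z` in the range of the word `l`, and `u` one in the domain of the
    -- letter `a`: their product lies in both.
    obtain ⟨t, ht⟩ := (hβ a).ideal_left e u u' hu'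
    obtain ⟨c, hc⟩ := (isPartialAlgHom_wordSymm β hβ hu (FreeGroup.invRev l)).ideal_right u e d
      (by rwa [wordSymm_invRev, PEquiv.mem_iff_mem])
    rw [wordSymm_invRev, PEquiv.mem_iff_mem] at hc
    refine ⟨c, t, (PEquiv.mem_trans _ _ _ _).2 ⟨_, hc, ht⟩, ?_⟩
    have t_mul : t * y ∈ letterSymm β a z := by
      simpa only [mul_assoc, huz, hez] using (hβ a).mul _ _ _ _ ht hzy
    exact Option.mem_unique t_mul hzy

theorem hasLeftLocalUnits_ofGenerators (hR : ∀ x : R, ∃ e, e * x = x) :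
    (ofGenerators β hβ hu).HasLeftLocalUnits := by
  rintro g y ⟨x, hx⟩
  obtain ⟨d, e, he, hy⟩ := exists_unit_wordSymm hβ hu hR _ x y hx
  exact ⟨e, ⟨d, he⟩, hy⟩

theorem act_ofGenerators_eq {g : FreeGroup A} {x y : R} (hy : y ∈ freeSymm β g x)
    (hx : x ∈ (ofGenerators β hβ hu).D g⁻¹) : ((ofGenerators β hβ hu).act g ⟨x, hx⟩ : R) = y :=
  Option.get_of_mem _ hy

theorem act_symm_ofGenerators_eq {g : FreeGroup A} {x : R} (y : (ofGenerators β hβ hu).D g)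
    (hy : (y : R) ∈ freeSymm β g x) : (((ofGenerators β hβ hu).act g).symm y : R) = x := by
  have hx : x ∈ (ofGenerators β hβ hu).D g⁻¹ := ⟨y, by rwa [freeSymm_inv, PEquiv.mem_iff_mem]⟩
  have : (ofGenerators β hβ hu).act g ⟨x, hx⟩ = y :=
    Subtype.ext (act_ofGenerators_eq hβ hu hy hx)
  rw [← this, LinearEquiv.symm_apply_apply]

theorem delta_mul_delta_eq_of_mem [SMulCommClass K R R] [IsScalarTower K R R]
    {g h k : FreeGroup A} (hk : g * h = k) {u : R} (a : (ofGenerators β hβ hu).D g)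
    (ha : (a : R) ∈ freeSymm β g u) (b : (ofGenerators β hβ hu).D h)
    (c : (ofGenerators β hβ hu).D k) (hc : (c : R) ∈ freeSymm β g (u * b)) :
    (ofGenerators β hβ hu).delta g a * (ofGenerators β hβ hu).delta h b =
      (ofGenerators β hβ hu).delta k c := by
  rw [delta_mul_delta]
  refine delta_congr _ hk _ _ ?_
  rw [coe_mulHomogeneous, twistedMul]
  exact act_ofGenerators_eq hβ hu (by rwa [act_symm_ofGenerators_eq hβ hu a ha]) _

end Generators

end AlgPartialAction

/-! ### Leavitt families -/

namespace DirGraph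

variable {V : Type u} {A : Type v} {E : DirGraph V A} {K : Type w} [Field K]

section UniversalProperty

open LeavittGen

variable {B : Type*} [NonUnitalRing B] {φ : LeavittGen V A → B}

/-- A Leavitt `E`-family: a family of elements of a ring that satisfies the defining relations of
the Leavitt path algebra of `E`. -/
structure IsLeavittFamily (E : DirGraph V A) (φ : LeavittGen V A → B) : Prop where
  vertex_mul_self (x : V) : φ (vertex x) * φ (vertex x) = φ (vertex x)
  vertex_mul_of_ne {x y : V} (h : x ≠ y) : φ (vertex x) * φ (vertex y) = 0
  source_mul_edge (f : A) : φ (vertex (E.s f)) * φ (edge f) = φ (edge f)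
  edge_mul_range (f : A) : φ (edge f) * φ (vertex (E.r f)) = φ (edge f)
  range_mul_ghost (f : A) : φ (vertex (E.r f)) * φ (ghost f) = φ (ghost f)
  ghost_mul_source (f : A) : φ (ghost f) * φ (vertex (E.s f)) = φ (ghost f)
  ghost_mul_edge_self (f : A) : φ (ghost f) * φ (edge f) = φ (vertex (E.r f))
  ghost_mul_edge_of_ne {f g : A} (h : f ≠ g) : φ (ghost f) * φ (edge g) = 0
  vertex_eq_sum (x : V) (hfin : {f | E.s f = x}.Finite) (hne : {f | E.s f = x}.Nonempty) :
    φ (vertex x) = ∑ f ∈ hfin.toFinset, φ (edge f) * φ (ghost f)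

theorem isLeavittFamily_leavittGen : E.IsLeavittFamily (E.leavittGen K) where
  vertex_mul_self x := by
    simpa only [leavittGen, map_mul] using
      RingQuot.mkAlgHom_rel K (LeavittRel.vertex_idem (E := E) (K := K) x)
  vertex_mul_of_ne h := by
    simpa only [leavittGen, map_mul, map_zero] using
      RingQuot.mkAlgHom_rel K (LeavittRel.vertex_orth (E := E) (K := K) _ _ h)
  source_mul_edge f := by
    simpa only [leavittGen, map_mul] using
      RingQuot.mkAlgHom_rel K (LeavittRel.source_edge (E := E) (K := K) f)
  edge_mul_range f := by
    simpa only [leavittGen, map_mul] using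
      RingQuot.mkAlgHom_rel K (LeavittRel.edge_range (E := E) (K := K) f)
  range_mul_ghost f := by
    simpa only [leavittGen, map_mul] using
      RingQuot.mkAlgHom_rel K (LeavittRel.range_ghost (E := E) (K := K) f)
  ghost_mul_source f := by
    simpa only [leavittGen, map_mul] using
      RingQuot.mkAlgHom_rel K (LeavittRel.ghost_source (E := E) (K := K) f)
  ghost_mul_edge_self f := by
    simpa only [leavittGen, map_mul] using
      RingQuot.mkAlgHom_rel K (LeavittRel.ghost_edge_self (E := E) (K := K) f)
  ghost_mul_edge_of_ne h := by
    simpa only [leavittGen, map_mul, map_zero] using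
      RingQuot.mkAlgHom_rel K (LeavittRel.ghost_edge_ne (E := E) (K := K) _ _ h)
  vertex_eq_sum x hfin hne := by
    simpa only [leavittGen, map_mul, map_sum] using
      RingQuot.mkAlgHom_rel K (LeavittRel.vertex_sum (E := E) (K := K) x hfin hne)

/-- The Leavitt `E`-family that generates the Leavitt path algebra of `E`. -/
noncomputable def leavittPathAlgebraGen (E : DirGraph V A) (K : Type w) [Field K]
    (x : LeavittGen V A) : E.leavittPathAlgebra K :=
  ⟨E.leavittGen K x, NonUnitalAlgebra.subset_adjoin K ⟨x, rfl⟩⟩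

theorem isLeavittFamily_leavittPathAlgebraGen :
    E.IsLeavittFamily (E.leavittPathAlgebraGen K) where
  vertex_mul_self x := Subtype.ext (isLeavittFamily_leavittGen.vertex_mul_self x)
  vertex_mul_of_ne h := Subtype.ext (isLeavittFamily_leavittGen.vertex_mul_of_ne h)
  source_mul_edge f := Subtype.ext (isLeavittFamily_leavittGen.source_mul_edge f)
  edge_mul_range f := Subtype.ext (isLeavittFamily_leavittGen.edge_mul_range f)
  range_mul_ghost f := Subtype.ext (isLeavittFamily_leavittGen.range_mul_ghost f)
  ghost_mul_source f := Subtype.ext (isLeavittFamily_leavittGen.ghost_mul_source f)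
  ghost_mul_edge_self f := Subtype.ext (isLeavittFamily_leavittGen.ghost_mul_edge_self f)
  ghost_mul_edge_of_ne h := Subtype.ext (isLeavittFamily_leavittGen.ghost_mul_edge_of_ne h)
  vertex_eq_sum x hfin hne := Subtype.ext <| by
    simpa only [leavittPathAlgebraGen, AddSubmonoidClass.coe_finsetSum, MulMemClass.coe_mul] using
      isLeavittFamily_leavittGen.vertex_eq_sum x hfin hne

theorem adjoin_range_leavittPathAlgebraGen :
    NonUnitalAlgebra.adjoin K (Set.range (E.leavittPathAlgebraGen K)) = ⊤ := by
  refine NonUnitalAlgebra.eq_top_iff.2 fun ⟨y, hy⟩ => ?_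
  refine NonUnitalAlgebra.adjoin_induction (p := fun y hy =>
    (⟨y, hy⟩ : E.leavittPathAlgebra K) ∈
      NonUnitalAlgebra.adjoin K (Set.range (E.leavittPathAlgebraGen K)))
    ?_ (fun _ _ _ _ => add_mem) (zero_mem _) (fun _ _ _ _ => mul_mem)
    (fun k _ _ => SMulMemClass.smul_mem k) hy
  rintro _ ⟨x, rfl⟩
  exact NonUnitalAlgebra.subset_adjoin K ⟨x, rfl⟩

namespace IsLeavittFamily

variable [Module K B] [IsScalarTower K B B] [SMulCommClass K B B]

/-- The extension of a Leavitt `E`-family to the universal unital algebra on the Leavitt relations,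
with values in the unitization. -/
noncomputable def liftUnital (hφ : E.IsLeavittFamily φ) :
    RingQuot (E.LeavittRel K) →ₐ[K] Unitization K B :=
  RingQuot.liftAlgHom K ⟨FreeAlgebra.lift K fun x => (φ x : Unitization K B), by
    intro a b hab
    induction hab with simp only [freeGen, map_mul, map_zero, map_sum, FreeAlgebra.lift_ι_apply,
      ← Unitization.inr_mul]
    | vertex_idem x => rw [hφ.vertex_mul_self]
    | vertex_orth x y h => rw [hφ.vertex_mul_of_ne h, Unitization.inr_zero]
    | source_edge f => rw [hφ.source_mul_edge]
    | edge_range f => rw [hφ.edge_mul_range]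
    | range_ghost f => rw [hφ.range_mul_ghost]
    | ghost_source f => rw [hφ.ghost_mul_source]
    | ghost_edge_self f => rw [hφ.ghost_mul_edge_self]
    | ghost_edge_ne f g h => rw [hφ.ghost_mul_edge_of_ne h, Unitization.inr_zero]
    | vertex_sum x hfin hne =>
      rw [hφ.vertex_eq_sum x hfin hne]
      exact map_sum (Unitization.inrNonUnitalAlgHom K B) _ _⟩

theorem liftUnital_leavittGen (hφ : E.IsLeavittFamily φ) (x : LeavittGen V A) :
    hφ.liftUnital (E.leavittGen K x) = φ x := by
  rw [liftUnital, leavittGen, RingQuot.liftAlgHom_mkAlgHom_apply, freeGen,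
    FreeAlgebra.lift_ι_apply]

theorem fst_liftUnital (hφ : E.IsLeavittFamily φ) {y : RingQuot (E.LeavittRel K)}
    (hy : y ∈ E.leavittPathAlgebra K) : (hφ.liftUnital y).fst = 0 := by
  induction hy using NonUnitalAlgebra.adjoin_induction with
  | mem y hy =>
    obtain ⟨x, rfl⟩ := hy
    rw [liftUnital_leavittGen, Unitization.fst_inr]
  | add y z _ _ hy hz => rw [map_add, Unitization.fst_add, hy, hz, add_zero]
  | zero => rw [map_zero, Unitization.fst_zero]
  | mul y z _ _ hy _ => rw [map_mul, Unitization.fst_mul, hy, zero_mul]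
  | smul k y _ hy => rw [map_smul, Unitization.fst_smul, hy, smul_zero]

/-- The homomorphism from the Leavitt path algebra given by its universal property. -/
noncomputable def lift (hφ : E.IsLeavittFamily φ) : E.leavittPathAlgebra K →ₙₐ[K] B where
  toFun y := (hφ.liftUnital (y : RingQuot (E.LeavittRel K))).snd
  map_zero' := by simp only [ZeroMemClass.coe_zero, map_zero, Unitization.snd_zero]
  map_add' y z := by simp only [AddMemClass.coe_add, map_add, Unitization.snd_add]
  map_smul' k y := by simp only [SetLike.val_smul, map_smul, Unitization.snd_smul]; rfl
  map_mul' y z := by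
    simp only [MulMemClass.coe_mul, map_mul, Unitization.snd_mul, hφ.fst_liftUnital y.2,
      hφ.fst_liftUnital z.2, zero_smul, zero_add]

theorem lift_leavittPathAlgebraGen (hφ : E.IsLeavittFamily φ) (x : LeavittGen V A) :
    hφ.lift (E.leavittPathAlgebraGen K x) = φ x :=
  congrArg (fun z : Unitization K B => z.snd) (hφ.liftUnital_leavittGen x)

end IsLeavittFamily

end UniversalProperty

end DirGraph

namespace DirGraph

open LeavittGen

variable {V : Type u} {A : Type v} {E : DirGraph V A} {R : Type*} [NonUnitalRing R]
  {φ : LeavittGen V A → R}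

namespace IsLeavittFamily

theorem vertex_mul_edge_of_ne (hφ : E.IsLeavittFamily φ) {x : V} {f : A} (h : x ≠ E.s f) :
    φ (vertex x) * φ (edge f) = 0 := by
  rw [← hφ.source_mul_edge, ← mul_assoc, hφ.vertex_mul_of_ne h, zero_mul]

theorem ghost_mul_vertex_of_ne (hφ : E.IsLeavittFamily φ) {x : V} {f : A} (h : E.s f ≠ x) :
    φ (ghost f) * φ (vertex x) = 0 := by
  rw [← hφ.ghost_mul_source, mul_assoc, hφ.vertex_mul_of_ne h, mul_zero]

end IsLeavittFamily

/-- The monomial `l x l'*` in the generators `φ`: the product of the edges in `l`, the vertex `x`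
and the ghost edges of `l'` in reverse order. The lists need not be paths ending at `x`; if they
are not, the monomial of a Leavitt family vanishes. -/
def monomial (φ : LeavittGen V A → R) (l : List A) (x : V) (l' : List A) : R :=
  l.foldr (fun f y => φ (edge f) * y) (l'.foldr (fun f y => y * φ (ghost f)) (φ (vertex x)))

theorem monomial_nil (x : V) : monomial φ [] x [] = φ (vertex x) := rfl

theorem monomial_cons_left (f : A) (l : List A) (x : V) (l' : List A) :
    monomial φ (f :: l) x l' = φ (edge f) * monomial φ l x l' := rfl

theorem monomial_cons_right (l : List A) (x : V) (f : A) (l' : List A) :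
    monomial φ l x (f :: l') = monomial φ l x l' * φ (ghost f) := by
  induction l with
  | nil => rfl
  | cons g l ih => rw [monomial_cons_left, monomial_cons_left, ih, mul_assoc]

namespace IsLeavittFamily

variable (hφ : E.IsLeavittFamily φ)

include hφ

theorem ghost_mul_monomial_cons_self (f : A) (l : List A) (x : V) (l' : List A) :
    φ (ghost f) * monomial φ (f :: l) x l' = φ (vertex (E.r f)) * monomial φ l x l' := by
  rw [monomial_cons_left, ← mul_assoc, hφ.ghost_mul_edge_self]

theorem ghost_mul_monomial_cons_of_ne {f g : A} (h : f ≠ g) (l : List A) (x : V) (l' : List A) :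
    φ (ghost f) * monomial φ (g :: l) x l' = 0 := by
  rw [monomial_cons_left, ← mul_assoc, hφ.ghost_mul_edge_of_ne h, zero_mul]

theorem monomial_cons_mul_edge_self (l : List A) (x : V) (f : A) (l' : List A) :
    monomial φ l x (f :: l') * φ (edge f) = monomial φ l x l' * φ (vertex (E.r f)) := by
  rw [monomial_cons_right, mul_assoc, hφ.ghost_mul_edge_self]

theorem vertex_mul_monomial (v : V) (l : List A) (x : V) (l' : List A) :
    φ (vertex v) * monomial φ l x l' = 0 ∨
      φ (vertex v) * monomial φ l x l' = monomial φ l x l' := by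
  cases l with
  | nil =>
    induction l' with
    | nil =>
      by_cases h : v = x
      · exact .inr (h ▸ hφ.vertex_mul_self v)
      · exact .inl (hφ.vertex_mul_of_ne h)
    | cons f l' ih =>
      rw [monomial_cons_right, ← mul_assoc]
      exact ih.imp (fun h => by rw [h, zero_mul]) fun h => by rw [h]
  | cons f l =>
    rw [monomial_cons_left, ← mul_assoc]
    by_cases h : v = E.s f
    · exact .inr (by rw [h, hφ.source_mul_edge])
    · exact .inl (by rw [hφ.vertex_mul_edge_of_ne h, zero_mul])

theorem monomial_mul_vertex (l : List A) (x : V) (l' : List A) (v : V) :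
    monomial φ l x l' * φ (vertex v) = 0 ∨
      monomial φ l x l' * φ (vertex v) = monomial φ l x l' := by
  cases l' with
  | nil =>
    induction l with
    | nil =>
      by_cases h : x = v
      · exact .inr (h ▸ hφ.vertex_mul_self x)
      · exact .inl (hφ.vertex_mul_of_ne h)
    | cons f l ih =>
      rw [monomial_cons_left, mul_assoc]
      exact ih.imp (fun h => by rw [h, mul_zero]) fun h => by rw [h]
  | cons f l' =>
    rw [monomial_cons_right, mul_assoc]
    by_cases h : E.s f = v
    · exact .inr (by rw [← h, hφ.ghost_mul_source])
    · exact .inl (by rw [hφ.ghost_mul_vertex_of_ne h, mul_zero])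

theorem ghost_mul_monomial_nil (f : A) (l' : List A) :
    φ (ghost f) * monomial φ [] (E.s f) l' = monomial φ [] (E.r f) (l' ++ [f]) := by
  induction l' with
  | nil =>
    rw [List.nil_append, monomial_cons_right, monomial_nil, monomial_nil, hφ.ghost_mul_source,
      hφ.range_mul_ghost]
  | cons g l' ih =>
    rw [List.cons_append, monomial_cons_right, monomial_cons_right, ← mul_assoc, ih]

theorem ghost_mul_monomial_nil_of_ne {f : A} {x : V} (h : E.s f ≠ x) (l' : List A) :
    φ (ghost f) * monomial φ [] x l' = 0 := by
  induction l' with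
  | nil => exact hφ.ghost_mul_vertex_of_ne h
  | cons g l' ih => rw [monomial_cons_right, ← mul_assoc, ih, zero_mul]

end IsLeavittFamily

section MonomialSpan

variable {K : Type w} [CommRing K] [Module K R]

/-- The span of the monomials `l x l'*` for which `p l l'` holds. -/
def monomialSpan (K : Type w) [CommRing K] [Module K R] (φ : LeavittGen V A → R)
    (p : List A → List A → Prop) : Submodule K R :=
  Submodule.span K {y | ∃ l x l', p l l' ∧ monomial φ l x l' = y}

variable {p q : List A → List A → Prop}

theorem monomial_mem_monomialSpan {l l' : List A} (h : p l l') (x : V) :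
    monomial φ l x l' ∈ monomialSpan K φ p :=
  Submodule.subset_span ⟨l, x, l', h, rfl⟩

theorem monomialSpan_mono (h : ∀ l l', p l l' → q l l') :
    monomialSpan K φ p ≤ monomialSpan K φ q :=
  Submodule.span_mono fun _ ⟨l, x, l', hl, hy⟩ => ⟨l, x, l', h _ _ hl, hy⟩

@[elab_as_elim]
theorem monomialSpan_induction {C : R → Prop} (zero : C 0)
    (add : ∀ y z, C y → C z → C (y + z)) (smul : ∀ (k : K) y, C y → C (k • y))
    (monomial : ∀ l x l', p l l' → C (monomial φ l x l')) {y : R}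
    (hy : y ∈ monomialSpan K φ p) : C y := by
  induction hy using Submodule.span_induction with
  | mem y h =>
    obtain ⟨l, x, l', h, rfl⟩ := h
    exact monomial l x l' h
  | zero => exact zero
  | add y z _ _ hy hz => exact add y z hy hz
  | smul k y _ hy => exact smul k y hy

theorem map_mem_of_mem_monomialSpan {M : Type*} [AddCommGroup M] [Module K M] (T : R →ₗ[K] M)
    {N : Submodule K M} (h : ∀ l x l', p l l' → T (monomial φ l x l') ∈ N) {y : R}
    (hy : y ∈ monomialSpan K φ p) : T y ∈ N := by
  refine monomialSpan_induction ?_ (fun y z hy hz => ?_)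
    (fun k y hy => ?_) h hy
  · rw [map_zero]
    exact zero_mem N
  · rw [map_add]
    exact add_mem hy hz
  · rw [map_smul]
    exact N.smul_mem k hy

namespace IsLeavittFamily

variable (hφ : E.IsLeavittFamily φ)

include hφ

theorem vertex_mul_mem_monomialSpan [SMulCommClass K R R] (v : V) {y : R}
    (hy : y ∈ monomialSpan K φ p) : φ (vertex v) * y ∈ monomialSpan K φ p := by
  refine map_mem_of_mem_monomialSpan (LinearMap.mulLeft K (φ (vertex v))) (fun l x l' h => ?_) hy
  rw [LinearMap.mulLeft_apply]
  obtain h0 | h0 := hφ.vertex_mul_monomial v l x l' <;> rw [h0]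
  · exact zero_mem _
  · exact monomial_mem_monomialSpan h x

theorem mul_vertex_mem_monomialSpan [IsScalarTower K R R] (v : V) {y : R}
    (hy : y ∈ monomialSpan K φ p) : y * φ (vertex v) ∈ monomialSpan K φ p := by
  refine map_mem_of_mem_monomialSpan (LinearMap.mulRight K (φ (vertex v))) (fun l x l' h => ?_) hy
  rw [LinearMap.mulRight_apply]
  obtain h0 | h0 := hφ.monomial_mul_vertex l x l' v <;> rw [h0]
  · exact zero_mem _
  · exact monomial_mem_monomialSpan h x

theorem gen_mem_monomialSpan (t : LeavittGen V A) :
    φ t ∈ monomialSpan K φ fun _ _ => True := by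
  cases t with
  | vertex x => exact monomial_mem_monomialSpan (l := []) (l' := []) trivial x
  | edge f =>
    rw [← hφ.edge_mul_range]
    exact monomial_mem_monomialSpan (l := [f]) (l' := []) trivial (E.r f)
  | ghost f =>
    rw [← hφ.range_mul_ghost]
    exact monomial_mem_monomialSpan (l := []) (l' := [f]) trivial (E.r f)

variable [SMulCommClass K R R]

theorem gen_mul_mem_monomialSpan (t : LeavittGen V A) {y : R}
    (hy : y ∈ monomialSpan K φ fun _ _ => True) :
    φ t * y ∈ monomialSpan K φ fun _ _ => True := by
  refine map_mem_of_mem_monomialSpan (LinearMap.mulLeft K (φ t)) (fun l x l' _ => ?_) hy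
  rw [LinearMap.mulLeft_apply]
  cases t with
  | vertex v => exact hφ.vertex_mul_mem_monomialSpan v (monomial_mem_monomialSpan trivial x)
  | edge f => exact monomial_mem_monomialSpan (l := f :: l) trivial x
  | ghost f =>
    cases l with
    | nil =>
      by_cases h : E.s f = x
      · rw [← h, hφ.ghost_mul_monomial_nil]
        exact monomial_mem_monomialSpan trivial _
      · rw [hφ.ghost_mul_monomial_nil_of_ne h]
        exact zero_mem _
    | cons g l =>
      by_cases h : f = g
      · rw [h, hφ.ghost_mul_monomial_cons_self]
        exact hφ.vertex_mul_mem_monomialSpan _ (monomial_mem_monomialSpan trivial x)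
      · rw [hφ.ghost_mul_monomial_cons_of_ne h]
        exact zero_mem _

theorem adjoin_range_le_monomialSpan [IsScalarTower K R R] {y : R}
    (hy : y ∈ NonUnitalAlgebra.adjoin K (Set.range φ)) :
    y ∈ monomialSpan K φ fun _ _ => True := by
  suffices h : y ∈ monomialSpan K φ (fun _ _ => True) ∧
      ∀ z ∈ monomialSpan K φ (fun _ _ => True), y * z ∈ monomialSpan K φ fun _ _ => True from h.1
  induction hy using NonUnitalAlgebra.adjoin_induction with
  | mem y hy =>
    obtain ⟨t, rfl⟩ := hy
    exact ⟨hφ.gen_mem_monomialSpan t, fun z hz => hφ.gen_mul_mem_monomialSpan t hz⟩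
  | add y y' _ _ hy hy' =>
    exact ⟨add_mem hy.1 hy'.1, fun z hz => by rw [add_mul]; exact add_mem (hy.2 z hz) (hy'.2 z hz)⟩
  | zero => exact ⟨zero_mem _, fun z _ => by rw [zero_mul]; exact zero_mem _⟩
  | mul y y' _ _ hy hy' =>
    exact ⟨hy.2 _ hy'.1, fun z hz => by rw [mul_assoc]; exact hy.2 _ (hy'.2 z hz)⟩
  | smul k y _ hy =>
    exact ⟨Submodule.smul_mem _ k hy.1, fun z hz => by
      rw [smul_mul_assoc]; exact Submodule.smul_mem _ k (hy.2 z hz)⟩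

end IsLeavittFamily

end MonomialSpan

end DirGraph

/-! ### Graded uniqueness -/

namespace DirGraph

open LeavittGen

section WordDegree

variable {A : Type v}

/-- The degree in the free group of the monomials `l x l'*`. -/
def wordDegree (l l' : List A) : FreeGroup A :=
  (l.map FreeGroup.of).prod * ((l'.map FreeGroup.of).prod)⁻¹

theorem wordDegree_cons_left (f : A) (l l' : List A) :
    wordDegree (f :: l) l' = FreeGroup.of f * wordDegree l l' := by
  simp only [wordDegree, List.map_cons, List.prod_cons, mul_assoc]

theorem wordDegree_cons_right (l : List A) (f : A) (l' : List A) :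
    wordDegree l (f :: l') = wordDegree l l' * (FreeGroup.of f)⁻¹ := by
  simp only [wordDegree, List.map_cons, List.prod_cons, mul_inv_rev, mul_assoc]

theorem wordDegree_append (l l' c : List A) : wordDegree (l ++ c) (l' ++ c) = wordDegree l l' := by
  simp only [wordDegree, List.map_append, List.prod_append, mul_inv_rev, mul_assoc,
    mul_inv_cancel_left]

/-- The pair `(m, m')` arises from `(l, l')` by appending the same word to both. -/
def IsCommonExtension (l l' m m' : List A) : Prop := ∃ c, m = l ++ c ∧ m' = l' ++ c

theorem exists_isCommonExtension_reduced (m m' : List A) : ∃ l l' : List A,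
    IsCommonExtension l l' m m' ∧ ∀ f ∈ l.getLast?, ∀ g ∈ l'.getLast?, f ≠ g := by
  induction m using List.reverseRecOn generalizing m' with
  | nil => exact ⟨[], m', ⟨[], rfl, m'.append_nil.symm⟩, by simp⟩
  | append_singleton m f ih =>
    obtain rfl | ⟨m', g, rfl⟩ := m'.eq_nil_or_concat'
    · exact ⟨m ++ [f], [], ⟨[], (List.append_nil _).symm, rfl⟩, by simp⟩
    by_cases hfg : f = g
    · obtain ⟨l, l', ⟨c, rfl, rfl⟩, h⟩ := ih m'
      exact ⟨l, l', ⟨c ++ [f], by simp, by simp [hfg]⟩, h⟩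
    · exact ⟨m ++ [f], m' ++ [g], ⟨[], by simp, by simp⟩, by simpa using hfg⟩

theorem exists_isCommonExtension_of_wordDegree_eq (g : FreeGroup A) :
    ∃ l l' : List A, ∀ m m', wordDegree m m' = g → IsCommonExtension l l' m m' := by
  by_cases hg : ∃ l l' : List A, wordDegree l l' = g ∧
      ∀ f ∈ l.getLast?, ∀ h ∈ l'.getLast?, f ≠ h
  · obtain ⟨l, l', rfl, hl⟩ := hg
    refine ⟨l, l', fun m m' h => ?_⟩
    obtain ⟨l₀, l₀', ⟨c, rfl, rfl⟩, h₀⟩ := exists_isCommonExtension_reduced m m'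
    rw [wordDegree_append] at h
    obtain ⟨rfl, rfl⟩ := quot_injective h₀ hl h
    exact ⟨c, rfl, rfl⟩
  · refine ⟨[], [], fun m m' h => ?_⟩
    obtain ⟨l₀, l₀', ⟨c, rfl, rfl⟩, h₀⟩ := exists_isCommonExtension_reduced m m'
    rw [wordDegree_append] at h
    exact absurd ⟨l₀, l₀', h, h₀⟩ hg

end WordDegree

variable {V : Type u} {A : Type v} {E : DirGraph V A} {K : Type w} [CommRing K]
  {R : Type*} [NonUnitalRing R] [Module K R] {φ : LeavittGen V A → R}

/-- The span of the monomials `l x l*` with `l` of length at most `n`. -/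
def diagonalSpan (K : Type w) [CommRing K] [Module K R] (φ : LeavittGen V A → R) (n : ℕ) :
    Submodule K R :=
  monomialSpan K φ fun l l' => l = l' ∧ l.length ≤ n

theorem exists_mem_diagonalSpan {y : R} (hy : y ∈ monomialSpan K φ Eq) :
    ∃ n, y ∈ diagonalSpan K φ n := by
  refine monomialSpan_induction ⟨0, zero_mem _⟩ ?_ ?_ ?_ hy
  · rintro y z ⟨m, hm⟩ ⟨n, hn⟩
    exact ⟨m + n, add_mem (monomialSpan_mono (fun _ _ h => ⟨h.1, by lia⟩) hm)
      (monomialSpan_mono (fun _ _ h => ⟨h.1, by lia⟩) hn)⟩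
  · rintro k y ⟨n, hn⟩
    exact ⟨n, Submodule.smul_mem _ k hn⟩
  · rintro l x _ rfl
    exact ⟨l.length, monomial_mem_monomialSpan ⟨rfl, le_rfl⟩ x⟩

namespace IsLeavittFamily

variable [SMulCommClass K R R] (hφ : E.IsLeavittFamily φ)

include hφ

theorem edge_mul_ghost_mul_monomial_cons (f : A) (l : List A) (x : V) (l' : List A) :
    φ (edge f) * (φ (ghost f) * monomial φ (f :: l) x l') = monomial φ (f :: l) x l' := by
  rw [hφ.ghost_mul_monomial_cons_self, ← mul_assoc, hφ.edge_mul_range, monomial_cons_left]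

theorem monomial_cons_mul_edge_mul_ghost (l : List A) (x : V) (f : A) (l' : List A) :
    monomial φ l x (f :: l') * φ (edge f) * φ (ghost f) = monomial φ l x (f :: l') := by
  rw [hφ.monomial_cons_mul_edge_self, mul_assoc, hφ.range_mul_ghost, monomial_cons_right]

theorem ghost_mul_mul_edge_mem_diagonalSpan [IsScalarTower K R R] (f : A) {n : ℕ} {y : R}
    (hy : y ∈ diagonalSpan K φ (n + 1)) :
    φ (ghost f) * y * φ (edge f) ∈ diagonalSpan K φ n := by
  refine map_mem_of_mem_monomialSpan
    (LinearMap.mulRight K (φ (edge f)) ∘ₗ LinearMap.mulLeft K (φ (ghost f))) ?_ hy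
  rintro l x _ ⟨rfl, hl⟩
  rw [LinearMap.comp_apply, LinearMap.mulLeft_apply, LinearMap.mulRight_apply]
  cases l with
  | nil =>
    rw [monomial_nil]
    by_cases h : E.s f = x
    · rw [← h, hφ.ghost_mul_source, hφ.ghost_mul_edge_self]
      exact monomial_mem_monomialSpan (l := []) (l' := []) ⟨rfl, n.zero_le⟩ _
    · rw [hφ.ghost_mul_vertex_of_ne h, zero_mul]
      exact zero_mem _
  | cons g l =>
    by_cases h : f = g
    · rw [h, hφ.ghost_mul_monomial_cons_self, mul_assoc, hφ.monomial_cons_mul_edge_self]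
      exact hφ.vertex_mul_mem_monomialSpan _ <| hφ.mul_vertex_mem_monomialSpan _ <|
        monomial_mem_monomialSpan ⟨rfl, Nat.le_of_succ_le_succ hl⟩ x
    · rw [hφ.ghost_mul_monomial_cons_of_ne h, zero_mul]
      exact zero_mem _

theorem ghost_mul_mul_edge_mul_ghost [IsScalarTower K R R] (f : A) {y : R}
    (hy : y ∈ monomialSpan K φ Eq) :
    φ (ghost f) * y * φ (edge f) * φ (ghost f) = φ (ghost f) * y := by
  refine monomialSpan_induction (by simp only [mul_zero, zero_mul]) (fun y z hy hz => ?_)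
    (fun k y hy => ?_) ?_ hy
  · simp only [mul_add, add_mul, hy, hz]
  · simp only [mul_smul_comm, smul_mul_assoc, hy]
  · rintro l x _ rfl
    cases l with
    | nil =>
      rw [monomial_nil]
      by_cases h : E.s f = x
      · rw [← h, hφ.ghost_mul_source, hφ.ghost_mul_edge_self, hφ.range_mul_ghost]
      · simp only [hφ.ghost_mul_vertex_of_ne h, zero_mul]
    | cons g l =>
      by_cases h : f = g
      · rw [h, mul_assoc, mul_assoc, ← mul_assoc (monomial φ _ _ _),
          hφ.monomial_cons_mul_edge_mul_ghost]
      · simp only [hφ.ghost_mul_monomial_cons_of_ne h, zero_mul]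

open Filter in
theorem eventually_sum_vertex_mul {p : List A → List A → Prop} {y : R}
    (hy : y ∈ monomialSpan K φ p) :
    ∀ᶠ S : Finset V in atTop, ∑ x ∈ S, φ (vertex x) * y = y := by
  refine monomialSpan_induction (by simp) (fun y z hy hz => ?_) (fun k y hy => ?_)
    (fun l x l' _ => ?_) hy
  · filter_upwards [hy, hz] with S hy hz
    simp only [mul_add, Finset.sum_add_distrib, hy, hz]
  · filter_upwards [hy] with S hy
    simp only [mul_smul_comm, ← Finset.smul_sum, hy]
  · obtain ⟨v, hv⟩ : ∃ v, φ (vertex v) * monomial φ l x l' = monomial φ l x l' := by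
      cases l with
      | nil =>
        refine ⟨x, ?_⟩
        clear * - hφ
        induction l' with
        | nil => exact hφ.vertex_mul_self x
        | cons f l' ih => rw [monomial_cons_right, ← mul_assoc, ih]
      | cons f l => exact ⟨E.s f, by rw [monomial_cons_left, ← mul_assoc, hφ.source_mul_edge]⟩
    filter_upwards [eventually_ge_atTop {v}] with S hS
    rw [Finset.sum_eq_single_of_mem v (hS (Finset.mem_singleton_self v)) fun u _ hu => ?_, hv]
    rw [← hv, ← mul_assoc, hφ.vertex_mul_of_ne hu, zero_mul]

theorem eq_zero_of_vertex_mul_eq_zero {p : List A → List A → Prop} {y : R}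
    (hy : y ∈ monomialSpan K φ p) (h : ∀ v, φ (vertex v) * y = 0) : y = 0 := by
  obtain ⟨S, hS⟩ := (hφ.eventually_sum_vertex_mul hy).exists
  rw [← hS]
  exact Finset.sum_eq_zero fun v _ => h v

open Filter in
theorem exists_eventually_sum_edge_mul_ghost_mul (v : V) {y : R}
    (hy : y ∈ monomialSpan K φ Eq) : ∃ k : K, ∀ᶠ F : Finset A in atTop,
      ∑ f ∈ F, φ (edge f) * (φ (ghost f) * (φ (vertex v) * y - k • φ (vertex v))) =
        φ (vertex v) * y - k • φ (vertex v) := by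
  refine monomialSpan_induction ⟨0, by simp⟩ ?_ ?_ ?_ hy
  · rintro y z ⟨k, hk⟩ ⟨k', hk'⟩
    refine ⟨k + k', ?_⟩
    filter_upwards [hk, hk'] with F h h'
    simp only [mul_add, add_smul, add_sub_add_comm, Finset.sum_add_distrib, h, h']
  · rintro c y ⟨k, hk⟩
    refine ⟨c * k, ?_⟩
    filter_upwards [hk] with F h
    simp only [mul_smul_comm, mul_smul, ← smul_sub, ← Finset.smul_sum, h]
  · rintro l x _ rfl
    cases l with
    | nil =>
      by_cases h : v = x
      · exact ⟨1, by simp [h, monomial_nil, hφ.vertex_mul_self]⟩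
      · exact ⟨0, by simp [monomial_nil, hφ.vertex_mul_of_ne h]⟩
    | cons g l =>
      refine ⟨0, ?_⟩
      simp only [zero_smul, sub_zero]
      obtain h | h := hφ.vertex_mul_monomial v (g :: l) x (g :: l) <;> rw [h]
      · simp
      filter_upwards [eventually_ge_atTop {g}] with F hF
      rw [Finset.sum_eq_single_of_mem g (hF (Finset.mem_singleton_self g)) fun f _ hf => ?_,
        hφ.edge_mul_ghost_mul_monomial_cons]
      rw [hφ.ghost_mul_monomial_cons_of_ne hf, mul_zero]

theorem ghost_mul_mem_monomialSpan_isCommonExtension {f : A} {l l' : List A} {y : R}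
    (hy : y ∈ monomialSpan K φ (IsCommonExtension (f :: l) l')) :
    φ (ghost f) * y ∈ monomialSpan K φ (IsCommonExtension l l') := by
  refine map_mem_of_mem_monomialSpan (LinearMap.mulLeft K (φ (ghost f))) ?_ hy
  rintro _ x _ ⟨c, rfl, rfl⟩
  rw [LinearMap.mulLeft_apply, List.cons_append, hφ.ghost_mul_monomial_cons_self]
  exact hφ.vertex_mul_mem_monomialSpan _ (monomial_mem_monomialSpan ⟨c, rfl, rfl⟩ x)

theorem edge_mul_ghost_mul_of_mem {f : A} {l l' : List A} {y : R}
    (hy : y ∈ monomialSpan K φ (IsCommonExtension (f :: l) l')) :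
    φ (edge f) * (φ (ghost f) * y) = y := by
  refine monomialSpan_induction (by simp only [mul_zero]) (fun y z hy hz => ?_)
    (fun k y hy => ?_) ?_ hy
  · simp only [mul_add, hy, hz]
  · simp only [mul_smul_comm, hy]
  · rintro _ x _ ⟨c, rfl, rfl⟩
    exact hφ.edge_mul_ghost_mul_monomial_cons f _ x _

omit [SMulCommClass K R R] in
theorem mul_edge_mem_monomialSpan_isCommonExtension [IsScalarTower K R R] {l : List A} {f : A}
    {l' : List A} {y : R} (hy : y ∈ monomialSpan K φ (IsCommonExtension l (f :: l'))) :
    y * φ (edge f) ∈ monomialSpan K φ (IsCommonExtension l l') := by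
  refine map_mem_of_mem_monomialSpan (LinearMap.mulRight K (φ (edge f))) ?_ hy
  rintro _ x _ ⟨c, rfl, rfl⟩
  rw [LinearMap.mulRight_apply, List.cons_append, hφ.monomial_cons_mul_edge_self]
  exact hφ.mul_vertex_mem_monomialSpan _ (monomial_mem_monomialSpan ⟨c, rfl, rfl⟩ x)

omit [SMulCommClass K R R] in
theorem mul_edge_mul_ghost_of_mem [IsScalarTower K R R] {l : List A} {f : A} {l' : List A} {y : R}
    (hy : y ∈ monomialSpan K φ (IsCommonExtension l (f :: l'))) :
    y * φ (edge f) * φ (ghost f) = y := by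
  refine monomialSpan_induction (by simp only [zero_mul]) (fun y z hy hz => ?_)
    (fun k y hy => ?_) ?_ hy
  · simp only [add_mul, hy, hz]
  · simp only [smul_mul_assoc, hy]
  · rintro _ x _ ⟨c, rfl, rfl⟩
    exact hφ.monomial_cons_mul_edge_mul_ghost _ x f _

section GradedUniqueness

variable {B : Type*} [NonUnitalRing B] [Module K B] {Φ : R →ₙₐ[K] B}
  (hΦ : ∀ v (k : K), k • Φ (φ (vertex v)) = 0 → k = 0)

include hΦ

omit [SMulCommClass K R R] hφ in
theorem vertex_mul_eq_zero_of_eq_smul {v : V} {y : R} {k : K} (h0 : Φ y = 0)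
    (hk : φ (vertex v) * y = k • φ (vertex v)) : φ (vertex v) * y = 0 := by
  have h : k • Φ (φ (vertex v)) = 0 := by rw [← map_smul, ← hk, map_mul, h0, mul_zero]
  rw [hk, hΦ v k h, zero_smul]

theorem vertex_mul_eq_zero_of_mem_diagonalSpan_zero {y : R} (hy : y ∈ diagonalSpan K φ 0)
    (h0 : Φ y = 0) (v : V) : φ (vertex v) * y = 0 := by
  have h : LinearMap.mulLeft K (φ (vertex v)) y ∈ K ∙ φ (vertex v) := by
    refine map_mem_of_mem_monomialSpan _ ?_ hy
    rintro l x _ ⟨rfl, hl⟩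
    obtain rfl := List.length_eq_zero_iff.1 (Nat.le_zero.1 hl)
    rw [LinearMap.mulLeft_apply, monomial_nil]
    by_cases h : v = x
    · rw [h, hφ.vertex_mul_self]
      exact Submodule.mem_span_singleton_self _
    · rw [hφ.vertex_mul_of_ne h]
      exact zero_mem _
  obtain ⟨k, hk⟩ := Submodule.mem_span_singleton.1 h
  exact vertex_mul_eq_zero_of_eq_smul hΦ h0 hk.symm

omit [SMulCommClass K R R] in
theorem eq_zero_of_smul_ghost_eq_zero [IsScalarTower K R R] {f : A} {k : K}
    (h : k • φ (ghost f) = 0) : k = 0 :=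
  hΦ (E.r f) k (by
    rw [← hφ.ghost_mul_edge_self, ← map_smul, ← smul_mul_assoc, h, zero_mul, map_zero])

theorem vertex_mul_eq_zero_of_ghost_mul_eq_zero [IsScalarTower K R R] {y : R}
    (hy : y ∈ monomialSpan K φ Eq)
    (h0 : Φ y = 0) (hg : ∀ f, φ (ghost f) * y = 0) (v : V) : φ (vertex v) * y = 0 := by
  have hgv (f : A) : φ (ghost f) * (φ (vertex v) * y) = 0 := by
    by_cases h : E.s f = v
    · rw [← h, ← mul_assoc, hφ.ghost_mul_source, hg]
    · rw [← mul_assoc, hφ.ghost_mul_vertex_of_ne h, zero_mul]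
  obtain ⟨k, hk⟩ := hφ.exists_eventually_sum_edge_mul_ghost_mul v hy
  obtain ⟨F, hF⟩ := hk.exists
  simp only [mul_sub, hgv, zero_sub, mul_smul_comm, mul_neg] at hF
  by_cases hs : E.IsSink v
  · refine vertex_mul_eq_zero_of_eq_smul hΦ h0 (k := k) (sub_eq_zero.1 ?_)
    rw [← hF]
    refine Finset.sum_eq_zero fun f _ => ?_
    rw [hφ.ghost_mul_vertex_of_ne (hs f), mul_zero, smul_zero, neg_zero]
  by_cases hinf : E.IsInfiniteEmitter v
  · -- An edge `f` that leaves `v` outside `F` annihilates the sum over `F`, which forces `k = 0`.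
    obtain ⟨f, rfl, hfF⟩ := hinf.exists_notMem_finset F
    have h : φ (ghost f) * (φ (vertex (E.s f)) * y - k • φ (vertex (E.s f))) = 0 := by
      rw [← hF, Finset.mul_sum]
      refine Finset.sum_eq_zero fun g hg => ?_
      rw [mul_neg, mul_smul_comm, ← mul_assoc,
        hφ.ghost_mul_edge_of_ne (ne_of_mem_of_not_mem hg hfF).symm, zero_mul, smul_zero, neg_zero]
    rw [mul_sub, hgv, mul_smul_comm, hφ.ghost_mul_source, zero_sub, neg_eq_zero] at h
    have hk0 : k = 0 := hφ.eq_zero_of_smul_ghost_eq_zero hΦ h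
    simpa only [hk0, zero_smul, neg_zero, Finset.sum_const_zero, sub_zero] using hF.symm
  · obtain ⟨f, hf⟩ := not_forall_not.1 hs
    rw [hφ.vertex_eq_sum v (Set.not_infinite.1 hinf) ⟨f, hf⟩, Finset.sum_mul]
    exact Finset.sum_eq_zero fun f _ => by rw [mul_assoc, hg, mul_zero]

variable [IsScalarTower K R R]

theorem eq_zero_of_mem_diagonalSpan {n : ℕ} {y : R} (hy : y ∈ diagonalSpan K φ n)
    (h0 : Φ y = 0) : y = 0 := by
  refine hφ.eq_zero_of_vertex_mul_eq_zero hy ?_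
  induction n generalizing y with
  | zero => exact hφ.vertex_mul_eq_zero_of_mem_diagonalSpan_zero hΦ hy h0
  | succ n ih =>
    have hd : y ∈ monomialSpan K φ Eq := monomialSpan_mono (fun _ _ h => h.1) hy
    refine hφ.vertex_mul_eq_zero_of_ghost_mul_eq_zero hΦ hd h0 fun f => ?_
    have hf := hφ.ghost_mul_mul_edge_mem_diagonalSpan f hy
    have h : φ (ghost f) * y * φ (edge f) = 0 := hφ.eq_zero_of_vertex_mul_eq_zero hf
      (ih hf (by rw [map_mul, map_mul, h0, mul_zero, zero_mul]))
    rw [← hφ.ghost_mul_mul_edge_mul_ghost f hd, h, zero_mul]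

theorem eq_zero_of_mem_monomialSpan_isCommonExtension {l l' : List A} {y : R}
    (hy : y ∈ monomialSpan K φ (IsCommonExtension l l')) (h0 : Φ y = 0) : y = 0 := by
  induction l generalizing y with
  | nil =>
    induction l' generalizing y with
    | nil =>
      obtain ⟨n, hn⟩ := exists_mem_diagonalSpan (y := y) <| monomialSpan_mono
        (fun m m' ⟨c, hc, hc'⟩ => hc.trans hc'.symm) hy
      exact hφ.eq_zero_of_mem_diagonalSpan hΦ hn h0
    | cons f l' ih =>
      have h := hφ.mul_edge_mem_monomialSpan_isCommonExtension hy
      rw [← hφ.mul_edge_mul_ghost_of_mem hy, ih h (by rw [map_mul, h0, zero_mul]), zero_mul]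
  | cons f l ih =>
    have h := hφ.ghost_mul_mem_monomialSpan_isCommonExtension hy
    rw [← hφ.edge_mul_ghost_mul_of_mem hy, ih h (by rw [map_mul, h0, mul_zero]), mul_zero]

end GradedUniqueness

theorem mem_iSup_monomialSpan_wordDegree [IsScalarTower K R R]
    (hgen : NonUnitalAlgebra.adjoin K (Set.range φ) = ⊤) (y : R) :
    y ∈ ⨆ g, monomialSpan K φ fun l l' => wordDegree l l' = g := by
  have hy : y ∈ NonUnitalAlgebra.adjoin K (Set.range φ) := hgen ▸ NonUnitalAlgebra.mem_top
  refine map_mem_of_mem_monomialSpan LinearMap.id (fun l x l' _ => ?_)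
    (hφ.adjoin_range_le_monomialSpan hy)
  exact Submodule.mem_iSup_of_mem (wordDegree l l') <| monomial_mem_monomialSpan
    (p := fun m m' => wordDegree m m' = wordDegree l l') rfl x

theorem injective_of_graded [IsScalarTower K R R]
    (hgen : NonUnitalAlgebra.adjoin K (Set.range φ) = ⊤)
    {B : Type*} [NonUnitalRing B] [Module K B] {Φ : R →ₙₐ[K] B}
    (hΦ : ∀ v (k : K), k • Φ (φ (vertex v)) = 0 → k = 0)
    {N : FreeGroup A → Submodule K B} (hN : iSupIndep N)
    (mul_mem : ∀ g h a b, a ∈ N g → b ∈ N h → a * b ∈ N (g * h))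
    (vertex_mem : ∀ v, Φ (φ (vertex v)) ∈ N 1) (edge_mem : ∀ f, Φ (φ (edge f)) ∈ N (.of f))
    (ghost_mem : ∀ f, Φ (φ (ghost f)) ∈ N (.of f)⁻¹) : Function.Injective Φ := by
  have map_monomial_mem (l : List A) (x : V) (l' : List A) :
      Φ (monomial φ l x l') ∈ N (wordDegree l l') := by
    induction l with
    | nil =>
      induction l' with
      | nil => exact vertex_mem x
      | cons f l' ih =>
        rw [monomial_cons_right, map_mul, wordDegree_cons_right]
        exact mul_mem _ _ _ _ ih (ghost_mem f)
    | cons f l ih =>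
      rw [monomial_cons_left, map_mul, wordDegree_cons_left]
      exact mul_mem _ _ _ _ (edge_mem f) ih
  refine (injective_iff_map_eq_zero Φ).2 fun y hy => ?_
  obtain ⟨F, hF, rfl⟩ := (Submodule.mem_iSup_iff_exists_finsupp _ _).1
    (hφ.mem_iSup_monomialSpan_wordDegree hgen y)
  refine Finset.sum_eq_zero fun g hg => ?_
  obtain ⟨l, l', hl⟩ := exists_isCommonExtension_of_wordDegree_eq g
  refine hφ.eq_zero_of_mem_monomialSpan_isCommonExtension hΦ (monomialSpan_mono hl (hF g)) ?_
  refine (iSupIndep_iff_finsetSum_eq_zero_imp_eq_zero N).1 hN F.support (fun h => Φ (F h))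
    (fun h _ => ?_) (by rw [← map_sum]; exact hy) g hg
  refine map_mem_of_mem_monomialSpan (Φ : R →ₗ[K] B) ?_ (hF h)
  rintro l x l' rfl
  exact map_monomial_mem l x l'

end IsLeavittFamily

end DirGraph

/-! ### The algebra `D^s(X)` -/

namespace DirGraph

variable {V : Type u} {A : Type v} {E : DirGraph V A} {K : Type w} [Field K]

@[elab_as_elim]
theorem DsX.induction {p : E.DsX K → Prop}
    (basic : ∀ S (hS : E.IsBasic S), p ⟨S.indicator 1, E.indicator_mem_DsX K hS⟩)
    (zero : p 0) (add : ∀ φ ψ, p φ → p ψ → p (φ + ψ)) (smul : ∀ (k : K) φ, p φ → p (k • φ))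
    (φ : E.DsX K) : p φ := by
  have exists_mem : ∀ φ ∈ Submodule.span K {φ | ∃ S, E.IsBasic S ∧ φ = S.indicator 1},
      ∃ hφ : φ ∈ E.DsX K, p ⟨φ, hφ⟩ := fun φ hφ => by
    induction hφ using Submodule.span_induction with
    | mem φ h =>
      obtain ⟨S, hS, rfl⟩ := h
      exact ⟨_, basic S hS⟩
    | zero => exact ⟨_, zero⟩
    | add φ ψ _ _ ihφ ihψ => exact ⟨_, add _ _ ihφ.2 ihψ.2⟩
    | smul k φ _ ih => exact ⟨_, smul k _ ih.2⟩
  exact (exists_mem φ ((span_generators (E := E) (K := K)).le φ.2)).2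

theorem indicator_mul_self (S : Set E.Boundary) :
    (S.indicator 1 : E.Boundary → K) * S.indicator 1 = S.indicator 1 := by
  rw [← Set.inter_indicator_one, Set.inter_self]

theorem DsX.exists_mul_eq_self (φ : E.DsX K) : ∃ e : E.DsX K, e * φ = φ := by
  induction φ using DsX.induction with
  | basic S hS =>
    exact ⟨⟨S.indicator 1, E.indicator_mem_DsX K hS⟩, Subtype.ext (indicator_mul_self S)⟩
  | zero => exact ⟨0, zero_mul 0⟩
  | add φ ψ hφ hψ =>
    obtain ⟨d, hd⟩ := hφ
    obtain ⟨e, he⟩ := hψ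
    refine ⟨d + e - d * e, ?_⟩
    have de_mul_φ : d * e * φ = e * φ := by rw [mul_right_comm, hd, mul_comm]
    have de_mul_ψ : d * e * ψ = d * ψ := by rw [mul_assoc, he]
    rw [sub_mul, add_mul, mul_add, mul_add, mul_add, hd, he, de_mul_φ, de_mul_ψ]
    abel
  | smul k φ hφ =>
    obtain ⟨e, he⟩ := hφ
    exact ⟨e, by rw [mul_smul_comm, he]⟩

theorem one_of (f : A) :
    E.one K (FreeGroup.of f) = {ξ : E.Boundary | ξ.edge 0 = some f}.indicator 1 := by
  rw [one, Set.ext (mem_cyl_of f)]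
  rfl

theorem one_of_inv (f : A) :
    E.one K (FreeGroup.of f)⁻¹ = {ξ : E.Boundary | ξ.src = E.r f}.indicator 1 := by
  rw [one, Set.ext (mem_cyl_of_inv f)]
  rfl

theorem src_indicator_eq_sum (x : V) (hfin : {f | E.s f = x}.Finite)
    (hne : {f | E.s f = x}.Nonempty) :
    ({ξ : E.Boundary | ξ.src = x}.indicator 1 : E.Boundary → K) =
      ∑ f ∈ hfin.toFinset, E.one K (FreeGroup.of f) := by
  obtain ⟨f, hf⟩ := hne
  rw [← emitterSeries_eq K fun hs => hs f hf]
  ext ξ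
  rw [Finset.sum_apply, emitterSeries]
  exact (finsum_set_coe_eq_finsum_mem (f := fun f => E.one K (FreeGroup.of f) ξ)
    {f | E.s f = x}).trans (finsum_mem_eq_finite_toFinset_sum _ hfin)

theorem src_indicator_mem_DsX {x : V} (hx : ¬ E.IsIsolated x) :
    ({ξ : E.Boundary | ξ.src = x}.indicator 1 : E.Boundary → K) ∈ E.DsX K := by
  by_cases hr : ∃ f, E.r f = x
  · exact E.indicator_mem_DsX K (.src x (Or.inl hr))
  by_cases hi : E.IsInfiniteEmitter x
  · exact E.indicator_mem_DsX K (.src x (Or.inr hi))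
  have hne : {f | E.s f = x}.Nonempty := by
    by_contra h
    exact hx ⟨fun f hf => h ⟨f, hf⟩, fun f hf => hr ⟨f, hf⟩⟩
  rw [src_indicator_eq_sum x (Set.not_infinite.1 hi) hne]
  exact sum_mem fun f _ => E.one_mem K _ (of_ne_one f)

theorem push_one_inv (f : A) :
    E.push K f (E.one K (FreeGroup.of f)⁻¹) = E.one K (FreeGroup.of f) := by
  rw [one_of_inv, push_indicator, one_of]
  congr 1
  ext ξ
  exact ⟨fun h => h.1, fun h => ⟨h, Boundary.src_shift h⟩⟩

theorem pull_one (f : A) :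
    E.pull K f (E.one K (FreeGroup.of f)) = E.one K (FreeGroup.of f)⁻¹ := by
  rw [← push_one_inv, pull_push, one_mul_one]

theorem pull_one_of_ne {f g : A} (h : f ≠ g) : E.pull K f (E.one K (FreeGroup.of g)) = 0 := by
  rw [one_of, pull_indicator]
  refine Set.indicator_eq_zero.2 (Set.disjoint_right.2 ?_)
  rintro ξ ⟨_, hg⟩ -
  exact h (Option.some_injective _ ((Boundary.edge_cons_zero _ _ _).symm.trans hg))

theorem pull_src (f : A) :
    E.pull K f ({ξ : E.Boundary | ξ.src = E.s f}.indicator 1) = E.one K (FreeGroup.of f)⁻¹ := by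
  rw [one_of_inv, pull_indicator]
  congr 1
  ext ξ
  exact ⟨fun h => h.1, fun h => ⟨h, Boundary.src_cons _ _ _⟩⟩

theorem Boundary.hasPrefix_cons_iff (ξ : E.Boundary) (f : A) (l : List A) (hl : f :: l ≠ [])
    (hc : (f :: l).IsChain fun f g => E.r f = E.s g) :
    ξ.HasPrefix ⟨f :: l, hl, hc⟩ ↔
      ξ.edge 0 = some f ∧ ∀ i < l.length, ξ.shift.edge i = l[i]? := by
  refine ⟨fun h => ⟨h 0 (by simp), fun i hi => ?_⟩, ?_⟩
  · rw [edge_shift]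
    exact h (i + 1) (by simpa using hi)
  · rintro ⟨h0, h⟩ (_ | i) hi
    · exact h0
    · exact (edge_shift ξ i).symm.trans (h i (by simpa using hi))

theorem Boundary.exists_src_eq (E : DirGraph V A) (x : V) : ∃ ξ : E.Boundary, ξ.src = x := by
  by_cases hx : E.IsSink x
  · exact ⟨.sink x hx, rfl⟩
  obtain ⟨f, -⟩ := not_forall_not.1 hx
  have : Nonempty A := ⟨f⟩
  choose! next s_next using fun y (hy : ¬ E.IsSink y) => not_forall_not.1 hy
  set step : V → V := fun y => E.r (next y)
  by_cases h : ∃ n, E.IsSink (step^[n] x)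
  · obtain ⟨n, hn⟩ := h
    clear hx
    induction n generalizing x with
    | zero => exact ⟨.sink x hn, rfl⟩
    | succ n ih =>
      by_cases hx : E.IsSink x
      · exact ⟨.sink x hx, rfl⟩
      obtain ⟨ξ, hξ⟩ := ih (step x) hn
      exact ⟨ξ.cons (next x) hξ, (src_cons _ _ _).trans (s_next x hx)⟩
  · refine ⟨.inf (fun n => next (step^[n] x)) fun i => ?_, s_next x hx⟩
    rw [s_next _ fun hi => h ⟨i + 1, hi⟩, Function.iterate_succ_apply']

end DirGraph

/-! ### The skew group ring of `β` -/

namespace DirGraph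

variable {V : Type u} {A : Type v} {E : DirGraph V A} {K : Type w} [Field K]

theorem hasLeftLocalUnits_betaAction : (E.betaAction K).HasLeftLocalUnits :=
  AlgPartialAction.hasLeftLocalUnits_ofGenerators _ _ DsX.exists_mul_eq_self

noncomputable instance : NonUnitalRing (E.betaAction K).SkewGroupRing where
  mul_assoc := (E.betaAction K).skew_mul_assoc hasLeftLocalUnits_betaAction

variable (E K) in
/-- The function `1_f` as an element of `D^s(X)`. -/
noncomputable def edgeOne (f : A) : E.DsX K := ⟨_, E.one_mem K _ (of_ne_one f)⟩

variable (E K) in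
/-- The function `1_{f⁻¹}` as an element of `D^s(X)`. -/
noncomputable def ghostOne (f : A) : E.DsX K := ⟨_, E.one_mem K _ (inv_ne_one.2 (of_ne_one f))⟩

theorem edgeOne_mem_edgeSymm (f : A) : E.edgeOne K f ∈ E.edgeSymm K f (E.ghostOne K f) := by
  rw [mem_edgeSymm, mem_oneMul_iff]
  exact ⟨one_mul_one _, push_one_inv f⟩

theorem edgeOne_mem_freeSymm (f : A) :
    E.edgeOne K f ∈ AlgPartialAction.freeSymm (E.edgeSymm K) (.of f) (E.ghostOne K f) := by
  rw [AlgPartialAction.freeSymm_of]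
  exact edgeOne_mem_edgeSymm f

theorem ghostOne_mem_freeSymm (f : A) :
    E.ghostOne K f ∈ AlgPartialAction.freeSymm (E.edgeSymm K) (.of f)⁻¹ (E.edgeOne K f) := by
  rw [AlgPartialAction.freeSymm_inv, PEquiv.mem_iff_mem]
  exact edgeOne_mem_freeSymm f

variable (E K) in
/-- The element `1_f δ_f`. -/
noncomputable def skewEdge (f : A) : (E.betaAction K).SkewGroupRing :=
  (E.betaAction K).delta (.of f) ⟨E.edgeOne K f, _, edgeOne_mem_freeSymm f⟩

variable (E K) in
/-- The element `1_{f⁻¹} δ_{f⁻¹}`. -/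
noncomputable def skewGhost (f : A) : (E.betaAction K).SkewGroupRing :=
  (E.betaAction K).delta (.of f)⁻¹ ⟨E.ghostOne K f, _, ghostOne_mem_freeSymm f⟩

variable (E K) in
/-- The embedding `φ ↦ φ δ_1` of `D^s(X)` into the skew group ring. -/
noncomputable def diagonal : E.DsX K →ₗ[K] (E.betaAction K).SkewGroupRing :=
  (E.betaAction K).delta 1 ∘ₗ
    LinearMap.id.codRestrict _ fun φ => by rw [(E.betaAction K).D_one]; trivial

theorem diagonal_injective : Function.Injective (E.diagonal K) := fun _ _ h =>
  congrArg Subtype.val ((E.betaAction K).delta_injective 1 h)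

theorem diagonal_mul_delta {g : FreeGroup A} (φ : E.DsX K) (x y : (E.betaAction K).D g)
    (h : φ * (x : E.DsX K) = y) :
    E.diagonal K φ * (E.betaAction K).delta g x = (E.betaAction K).delta g y :=
  ((E.betaAction K).delta_one_mul_delta g _ x).trans ((E.betaAction K).delta_congr rfl _ _ h)

theorem diagonal_mul_diagonal (φ ψ : E.DsX K) :
    E.diagonal K φ * E.diagonal K ψ = E.diagonal K (φ * ψ) :=
  diagonal_mul_delta φ _ _ rfl

theorem skewEdge_mul_delta (f : A) {g h : FreeGroup A} (hgh : .of f * g = h)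
    (x : (E.betaAction K).D g) (y : (E.betaAction K).D h)
    (hy : E.push K f (x : E.DsX K) = (y : E.DsX K)) :
    E.skewEdge K f * (E.betaAction K).delta g x = (E.betaAction K).delta h y := by
  refine AlgPartialAction.delta_mul_delta_eq_of_mem _ _ hgh _ (edgeOne_mem_freeSymm f) x y ?_
  rw [AlgPartialAction.freeSymm_of, mem_edgeSymm]
  refine ⟨⟨_, rfl⟩, ?_⟩
  calc E.push K f (E.one K (.of f)⁻¹ * (x : E.DsX K))
      = E.one K (.of f) * E.push K f (x : E.DsX K) := by rw [push_mul, push_one_inv]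
    _ = (y : E.DsX K) := by rw [one_mul_push, hy]

theorem skewGhost_mul_delta (f : A) {g h : FreeGroup A} (hgh : (.of f)⁻¹ * g = h)
    (x : (E.betaAction K).D g) (y : (E.betaAction K).D h)
    (hy : E.pull K f (x : E.DsX K) = (y : E.DsX K)) :
    E.skewGhost K f * (E.betaAction K).delta g x = (E.betaAction K).delta h y := by
  refine AlgPartialAction.delta_mul_delta_eq_of_mem _ _ hgh _ (ghostOne_mem_freeSymm f) x y ?_
  rw [AlgPartialAction.freeSymm_inv, AlgPartialAction.freeSymm_of, mem_edgeSymm_symm]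
  refine ⟨⟨_, rfl⟩, ?_⟩
  calc E.pull K f (E.one K (.of f) * (x : E.DsX K))
      = E.one K (.of f)⁻¹ * E.pull K f (x : E.DsX K) := by rw [pull_mul, pull_one]
    _ = (y : E.DsX K) := by rw [one_mul_pull, hy]

theorem skewEdge_mul_diagonal_mul_skewGhost (f : A) (φ : E.DsX K) :
    E.skewEdge K f * (E.diagonal K φ * E.skewGhost K f) =
      E.diagonal K ⟨E.push K f φ, push_mem f φ.2⟩ := by
  rw [skewGhost, diagonal_mul_delta φ _ ⟨_, (E.betaAction K).mul_mem_left _ _ _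
    ⟨_, ghostOne_mem_freeSymm f⟩⟩ rfl]
  refine skewEdge_mul_delta f (mul_inv_cancel _) _ _ ?_
  calc E.push K f ((φ : E.Boundary → K) * E.one K (.of f)⁻¹)
      = E.one K (.of f) * E.push K f φ := by rw [push_mul, push_one_inv, mul_comm]
    _ = E.push K f φ := one_mul_push f _

theorem skewEdge_mul_skewGhost (f : A) :
    E.skewEdge K f * E.skewGhost K f = E.diagonal K (E.edgeOne K f) :=
  skewEdge_mul_delta f (mul_inv_cancel _) _ _ (push_one_inv f)

section Family

variable (hE : ∀ x : V, ¬ E.IsIsolated x)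

/-- The characteristic function of the set of all elements of `X` with source `x`, as an element of
`D^s(X)`. -/
noncomputable def srcOne (K : Type w) [Field K] (x : V) : E.DsX K :=
  ⟨_, src_indicator_mem_DsX (hE x)⟩

/-- The Leavitt family in the skew group ring which induces the isomorphism. -/
noncomputable def skewGen (K : Type w) [Field K] :
    LeavittGen V A → (E.betaAction K).SkewGroupRing
  | .vertex x => E.diagonal K (srcOne hE K x)
  | .edge f => E.skewEdge K f
  | .ghost f => E.skewGhost K f

theorem srcOne_range (f : A) : srcOne hE K (E.r f) = E.ghostOne K f :=
  Subtype.ext (one_of_inv f).symm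

theorem srcOne_mul_self (x : V) : srcOne hE K x * srcOne hE K x = srcOne hE K x :=
  Subtype.ext (indicator_mul_self _)

theorem srcOne_mul_of_ne {x y : V} (h : x ≠ y) : srcOne hE K x * srcOne hE K y = 0 := by
  refine Subtype.ext ((Set.inter_indicator_one (s := {ξ : E.Boundary | ξ.src = x})).symm.trans
    (Set.indicator_eq_zero.2 (Set.disjoint_right.2 ?_)))
  rintro ξ ⟨hx, hy⟩ -
  exact h (hx.symm.trans hy)

theorem srcOne_mul_edgeOne (f : A) : srcOne hE K (E.s f) * E.edgeOne K f = E.edgeOne K f := by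
  refine Subtype.ext ?_
  change Set.indicator _ _ * E.one K (.of f) = E.one K (.of f)
  rw [one_of, ← Set.inter_indicator_one]
  exact congrArg (Set.indicator · 1)
    (Set.inter_eq_right.2 fun ξ hξ => Boundary.src_of_edge_zero hξ)

theorem srcOne_eq_sum (x : V) (hfin : {f | E.s f = x}.Finite) (hne : {f | E.s f = x}.Nonempty) :
    srcOne hE K x = ∑ f ∈ hfin.toFinset, E.edgeOne K f := by
  refine Subtype.ext ((src_indicator_eq_sum x hfin hne).trans ?_)
  simp only [AddSubmonoidClass.coe_finsetSum, edgeOne]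

theorem srcOne_ne_zero (x : V) : srcOne hE K x ≠ 0 := fun h => by
  obtain ⟨ξ, hξ⟩ := Boundary.exists_src_eq E x
  have mem : ξ ∈ {ξ : E.Boundary | ξ.src = x} := hξ
  exact one_ne_zero ((Set.indicator_of_mem mem (1 : E.Boundary → K)).symm.trans
    (congrFun (congrArg Subtype.val h) ξ))

theorem isLeavittFamily_skewGen : E.IsLeavittFamily (skewGen hE K) where
  vertex_mul_self x := by
    simp only [skewGen, diagonal_mul_diagonal, srcOne_mul_self]
  vertex_mul_of_ne h := by
    simp only [skewGen, diagonal_mul_diagonal, srcOne_mul_of_ne hE h, map_zero]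
  source_mul_edge f := diagonal_mul_delta _ _ _ (srcOne_mul_edgeOne hE f)
  edge_mul_range f := skewEdge_mul_delta f (mul_one _) _ _
    ((congrArg (E.push K f) (one_of_inv f).symm).trans (push_one_inv f))
  range_mul_ghost f := diagonal_mul_delta _ _ _ (by
    rw [srcOne_range hE f]
    exact Subtype.ext (one_mul_one _))
  ghost_mul_source f := skewGhost_mul_delta f (mul_one _) _ _ (pull_src f)
  ghost_mul_edge_self f := skewGhost_mul_delta f (inv_mul_cancel _) _ _
    ((pull_one f).trans (one_of_inv f))
  ghost_mul_edge_of_ne h :=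
    (skewGhost_mul_delta _ rfl _ 0 (pull_one_of_ne h)).trans (map_zero _)
  vertex_eq_sum x hfin hne := by
    simp only [skewGen, skewEdge_mul_skewGhost, srcOne_eq_sum hE x hfin hne, map_sum]

end Family

end DirGraph

/-! ### The isomorphism -/

namespace DirGraph

variable {V : Type u} {A : Type v} {E : DirGraph V A} {K : Type w} [Field K]
  (hE : ∀ x : V, ¬ E.IsIsolated x)

section Generation

variable {hE} {S : NonUnitalSubalgebra K (E.betaAction K).SkewGroupRing}
  (hS : ∀ t, skewGen hE K t ∈ S)

include hS

theorem diagonal_push_mem {f : A} {φ : E.DsX K} (hφ : E.diagonal K φ ∈ S) :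
    E.diagonal K ⟨E.push K f φ, push_mem f φ.2⟩ ∈ S := by
  rw [← skewEdge_mul_diagonal_mul_skewGhost]
  exact mul_mem (hS (.edge f)) (mul_mem hφ (hS (.ghost f)))

theorem diagonal_edgeOne_mem (f : A) : E.diagonal K (E.edgeOne K f) ∈ S := by
  rw [← skewEdge_mul_skewGhost]
  exact mul_mem (hS (.edge f)) (hS (.ghost f))

theorem diagonal_hasPrefix_mem (a : E.Path) :
    E.diagonal K ⟨_, E.indicator_mem_DsX K (.pre a)⟩ ∈ S := by
  obtain ⟨l, hl, hc⟩ := a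
  induction l with
  | nil => exact absurd rfl hl
  | cons f l ih =>
    rcases eq_or_ne l [] with rfl | hl'
    · convert diagonal_edgeOne_mem hS f using 2
      refine Subtype.ext (Eq.trans ?_ (one_of f).symm)
      refine congrArg (Set.indicator · 1) (Set.ext fun ξ => ?_)
      exact (Boundary.hasPrefix_cons_iff ξ f [] hl hc).trans
        (and_iff_left fun _ hi => absurd hi (Nat.not_lt_zero _))
    · convert diagonal_push_mem hS (f := f) (ih hl' hc.tail) using 2
      refine Subtype.ext (Eq.trans ?_ (push_indicator f _).symm)
      exact congrArg (Set.indicator · 1)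
        (Set.ext fun ξ => Boundary.hasPrefix_cons_iff ξ f l hl hc)

theorem diagonal_mem (φ : E.DsX K) : E.diagonal K φ ∈ S := by
  induction φ using DsX.induction with
  | basic T hT =>
    cases hT with
    | empty =>
      convert zero_mem S
      exact (congrArg (E.diagonal K) (Subtype.ext (Set.indicator_empty _))).trans (map_zero _)
    | src x _ => exact hS (.vertex x)
    | pre a => exact diagonal_hasPrefix_mem hS a
  | zero => simpa only [map_zero] using zero_mem S
  | add φ ψ hφ hψ => simpa only [map_add] using add_mem hφ hψ
  | smul k φ hφ => simpa only [map_smul] using SMulMemClass.smul_mem k hφ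

open Classical in
theorem delta_mem (g : FreeGroup A) (d : (E.betaAction K).D g) :
    (E.betaAction K).delta g d ∈ S := by
  obtain ⟨l, hl⟩ : ∃ l, g.toWord = l := ⟨_, rfl⟩
  induction l generalizing g with
  | nil =>
    obtain rfl := FreeGroup.toWord_eq_nil_iff.1 hl
    exact diagonal_mem hS d
  | cons a l ih =>
    obtain ⟨y, x, hx⟩ := d
    rw [AlgPartialAction.freeSymm, hl] at hx
    obtain ⟨z, hz, hzy⟩ := (PEquiv.mem_trans _ _ _ _).1 hx
    have toWord_mk : (FreeGroup.mk l).toWord = l := by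
      have reduced : FreeGroup.IsReduced (a :: l) := hl ▸ FreeGroup.isReduced_toWord
      have tail_reduced : FreeGroup.IsReduced l := List.IsChain.tail reduced
      rw [FreeGroup.toWord_mk, tail_reduced.reduce_eq]
    have hzD : z ∈ (E.betaAction K).D (FreeGroup.mk l) := by
      refine ⟨x, ?_⟩
      rwa [AlgPartialAction.freeSymm, toWord_mk]
    have mk_mul_mk : FreeGroup.mk [a] * FreeGroup.mk l = g := by
      rw [FreeGroup.mul_mk, List.singleton_append, ← hl, FreeGroup.mk_toWord]
    have hzS := ih _ ⟨z, hzD⟩ toWord_mk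
    obtain ⟨f, _ | _⟩ := a
    · rw [← skewGhost_mul_delta f mk_mul_mk ⟨z, hzD⟩ _ ((mem_edgeSymm_symm f z y).1 hzy).2]
      exact mul_mem (hS (.ghost f)) hzS
    · rw [← skewEdge_mul_delta f mk_mul_mk ⟨z, hzD⟩ _ ((mem_edgeSymm f z y).1 hzy).2]
      exact mul_mem (hS (.edge f)) hzS

theorem eq_top_of_skewGen_mem : S = ⊤ := by
  refine eq_top_iff.2 fun s _ => ?_
  induction s using AlgPartialAction.SkewGroupRing.induction with
  | zero => exact zero_mem S
  | add x y hx hy => exact add_mem (hx trivial) (hy trivial)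
  | delta g d => exact delta_mem hS g d

end Generation

/-- The homomorphism from the Leavitt path algebra to the partial skew group ring which maps `f` to
`1_f δ_f` and `f^*` to `1_{f⁻¹} δ_{f⁻¹}`. -/
noncomputable def leavittHom (K : Type w) [Field K] :
    E.leavittPathAlgebra K →ₙₐ[K] (E.betaAction K).SkewGroupRing :=
  (isLeavittFamily_skewGen hE).lift

theorem leavittHom_leavittPathAlgebraGen (t : LeavittGen V A) :
    leavittHom hE K (E.leavittPathAlgebraGen K t) = skewGen hE K t :=
  IsLeavittFamily.lift_leavittPathAlgebraGen _ t

theorem leavittHom_injective : Function.Injective (leavittHom hE K) := by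
  refine isLeavittFamily_leavittPathAlgebraGen.injective_of_graded
    adjoin_range_leavittPathAlgebraGen (fun v k hk => ?_)
    (E.betaAction K).iSupIndep_range_delta ?_ (fun v => ?_) (fun f => ?_) fun f => ?_
  · rw [leavittHom_leavittPathAlgebraGen] at hk
    have vertex_ne_zero := (map_ne_zero_iff _ diagonal_injective).2 (srcOne_ne_zero (K := K) hE v)
    exact (smul_eq_zero_iff_left vertex_ne_zero).1 hk
  · rintro g h _ _ ⟨x, rfl⟩ ⟨y, rfl⟩
    exact ⟨_, ((E.betaAction K).delta_mul_delta g h x y).symm⟩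
  all_goals
    rw [leavittHom_leavittPathAlgebraGen]
    exact ⟨_, rfl⟩

theorem leavittHom_surjective : Function.Surjective (leavittHom hE K) := by
  refine (NonUnitalAlgebra.range_eq_top K _).1 (eq_top_of_skewGen_mem (hE := hE) fun t => ?_)
  exact ⟨_, leavittHom_leavittPathAlgebraGen hE t⟩

end DirGraph

theorem theorem4p3 {V : Type u} {A : Type v} (E : DirGraph V A) (K : Type w) [Field K]
    (hE : ∀ x : V, ¬ E.IsIsolated x) :
    ∃ φ : E.leavittPathAlgebra K ≃+* (E.betaAction K).SkewGroupRing,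
      ∀ (k : K) (x : E.leavittPathAlgebra K), φ (k • x) = k • φ x :=
  ⟨RingEquiv.ofBijective (DirGraph.leavittHom hE K)
    ⟨DirGraph.leavittHom_injective hE, DirGraph.leavittHom_surjective hE⟩,
    fun k x => map_smul (DirGraph.leavittHom hE K) k x⟩
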